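/- Let $d\ge 1$, $R>0$, $h>0$, and let $\pi:\mathbb{R}^d\to(0,\infty)$ be a positive, continuous, (possibly unnormalised) integrable target density; write $\pi(\mathrm{d}x)$ also for the probability distribution on $\mathbb{R}^d$ with density proportional to $\pi$. Let $\mathbb{S}^d\subset\mathbb{R}^{d+1}$ be the unit sphere, and let $\mathrm{SP}:\mathbb{S}^d\setminus\{(0,\dots,0,1)\}\to\mathbb{R}^d$, $\mathrm{SP}(z)=\left(\frac{Rz_1}{1-z_{d+1}},\dots,\frac{Rz_d}{1-z_{d+1}}\right)$, be the stereographic projection of radius $R$, with inverse given by $z_i=\frac{2Rx_i}{\|x\|^2+R^2}$ for $1\le i\le d$ and $z_{d+1}=\frac{\|x\|^2-R^2}{\|x\|^2+R^2}$. The Stereographic Projection Sampler (SPS) with radius $R$ and step size $h$ is the following Markov chain on $\mathbb{R}^d$. From the current state $x$, let $z=\mathrm{SP}^{-1}(x)$, draw $w\sim\mathcal{N}(0,h^2I_{d+1})$, let $v=w-\frac{(z^Tw)z}{\|z\|^2}$ and $\hat z=\frac{z+v}{\|z+v\|}$, and propose $\hat x=\mathrm{SP}(\hat z)$ (well defined with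 probability one). The next state is $\hat x$ with probability $$1\wedge\frac{\pi(\hat x)(R^2+\|\hat x\|^2)^d}{\pi(x)(R^2+\|x\|^2)^d},$$ and $x$ otherwise. Let $P$ be its transition kernel. SPS is called uniformly ergodic if there are $M<\infty$ and $\rho<1$ with $\|P^n(x,\cdot)-\pi\|_{\mathrm{TV}}\le M\rho^n$ for all $n\ge 0$ and all $x\in\mathbb{R}^d$, where $\|\mu-\nu\|_{\mathrm{TV}}=\sup_A|\mu(A)-\nu(A)|$. Theorem. SPS is uniformly ergodic if and only if $$\sup_{x\in\mathbb{R}^d}\pi(x)\,(R^2+\|x\|^2)^d<\infty.$$ -/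

import Mathlib

open MeasureTheory ProbabilityTheory
open scoped ENNReal

namespace SPS

noncomputable section

/-! ### Stereographic projection -/

/-- Stereographic projection of radius `R`, from the unit sphere in `ℝ^(d+1)` (without its north
pole `(0, …, 0, 1)`) to `ℝ^d`: `z ↦ (R z_i / (1 - z_{d+1}))_i`. It is defined here by the same
formula on all of `ℝ^(d+1)`; only its values on the sphere are used. -/
def stereo {d : ℕ} (R : ℝ) (z : EuclideanSpace ℝ (Fin (d + 1))) : EuclideanSpace ℝ (Fin d) :=
  WithLp.toLp 2 fun i => R * z i.castSucc / (1 - z (Fin.last d))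

/-- Inverse stereographic projection of radius `R`: the first `d` coordinates are
`2 R x_i / (‖x‖² + R²)` and the last one is `(‖x‖² - R²) / (‖x‖² + R²)`. -/
def stereoInv {d : ℕ} (R : ℝ) (x : EuclideanSpace ℝ (Fin d)) : EuclideanSpace ℝ (Fin (d + 1)) :=
  WithLp.toLp 2 (Fin.snoc (α := fun _ => ℝ) (fun i : Fin d => 2 * R * x i / (‖x‖ ^ 2 + R ^ 2))
    ((‖x‖ ^ 2 - R ^ 2) / (‖x‖ ^ 2 + R ^ 2)))

/-! ### The proposal -/

/-- The component of `w` that is tangent to the sphere at `z`: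
`w - ((zᵀ w) / ‖z‖²) z`. -/
def tangentPart {d : ℕ} (z w : EuclideanSpace ℝ (Fin (d + 1))) : EuclideanSpace ℝ (Fin (d + 1)) :=
  w - (inner ℝ z w / ‖z‖ ^ 2) • z

/-- The point of the sphere proposed from `z` when the Gaussian increment is `w`: move by the
tangential part of `w`, then re-project by normalising. -/
def spherePropose {d : ℕ} (z w : EuclideanSpace ℝ (Fin (d + 1))) :
    EuclideanSpace ℝ (Fin (d + 1)) :=
  ‖z + tangentPart z w‖⁻¹ • (z + tangentPart z w)

/-- The isotropic Gaussian law `N(0, h² I_n)` on `ℝ^n`. -/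
def isotropicGaussian (n : ℕ) (h : ℝ) : Measure (EuclideanSpace ℝ (Fin n)) :=
  (stdGaussian (EuclideanSpace ℝ (Fin n))).map (fun w => h • w)

instance (n : ℕ) (h : ℝ) : IsProbabilityMeasure (isotropicGaussian n h) :=
  Measure.isProbabilityMeasure_map (by fun_prop)

/-- The point of `ℝ^d` proposed from `x` when the Gaussian increment is `w`. -/
def propose {d : ℕ} (R : ℝ) (x : EuclideanSpace ℝ (Fin d)) (w : EuclideanSpace ℝ (Fin (d + 1))) :
    EuclideanSpace ℝ (Fin d) :=
  stereo R (spherePropose (stereoInv R x) w)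

theorem measurable_stereo {d : ℕ} (R : ℝ) : Measurable (stereo (d := d) R) := by
  unfold stereo
  refine (WithLp.measurable_toLp 2 _).comp (measurable_pi_lambda _ fun i => ?_)
  fun_prop

theorem measurable_stereoInv {d : ℕ} (R : ℝ) : Measurable (stereoInv (d := d) R) := by
  unfold stereoInv
  refine (WithLp.measurable_toLp 2 _).comp (measurable_pi_lambda _ fun i => ?_)
  refine Fin.lastCases ?_ (fun j => ?_) i
  · simp only [Fin.snoc_last]
    fun_prop
  · simp only [Fin.snoc_castSucc]
    fun_prop

theorem measurable_propose {d : ℕ} (R : ℝ) :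
    Measurable (Function.uncurry (propose (d := d) R)) := by
  unfold propose spherePropose tangentPart Function.uncurry
  refine (measurable_stereo R).comp ?_
  have h : Measurable fun a : EuclideanSpace ℝ (Fin d) × EuclideanSpace ℝ (Fin (d + 1)) =>
      stereoInv R a.1 := (measurable_stereoInv R).comp measurable_fst
  fun_prop

/-- The proposal kernel on `ℝ^d`: from `x`, draw `w ∼ N(0, h² I_{d+1})` and propose
`propose R x w`. -/
def proposalKernel (d : ℕ) (R h : ℝ) :
    Kernel (EuclideanSpace ℝ (Fin d)) (EuclideanSpace ℝ (Fin d)) :=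
  (Kernel.id ×ₖ Kernel.const _ (isotropicGaussian (d + 1) h)).map (Function.uncurry (propose R))

instance (d : ℕ) (R h : ℝ) : IsMarkovKernel (proposalKernel d R h) :=
  Kernel.IsMarkovKernel.map _ (measurable_propose R)

theorem proposalKernel_apply (d : ℕ) (R h : ℝ) (x : EuclideanSpace ℝ (Fin d)) :
    proposalKernel d R h x = (isotropicGaussian (d + 1) h).map (propose R x) := by
  rw [proposalKernel, Kernel.map_apply _ (measurable_propose R), Kernel.prod_apply,
    Kernel.id_apply, Kernel.const_apply, Measure.dirac_prod,
    Measure.map_map (measurable_propose R) (by fun_prop)]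
  rfl

/-! ### The accept/reject step -/

/-- The Metropolis–Hastings kernel with proposal kernel `Q` and acceptance probability `α`:
`P(x, A) = ∫_A α(x, y) Q(x, dy) + (1 - ∫ α(x, y) Q(x, dy)) δ_x(A)`. -/
def metropolisKernel {E : Type*} [MeasurableSpace E] (Q : Kernel E E) [IsSFiniteKernel Q]
    (α : E → E → ℝ≥0∞) : Kernel E E :=
  Q.withDensity α + Kernel.id.withDensity (fun x _ => 1 - ∫⁻ y, α x y ∂(Q x))

theorem metropolisKernel_apply {E : Type*} [MeasurableSpace E] (Q : Kernel E E)
    [IsSFiniteKernel Q] {α : E → E → ℝ≥0∞} (hα : Measurable (Function.uncurry α)) (x : E)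
    {A : Set E} (hA : MeasurableSet A) :
    metropolisKernel Q α x A =
      ∫⁻ y in A, α x y ∂(Q x) + (1 - ∫⁻ y, α x y ∂(Q x)) * Measure.dirac x A := by
  have h1 : Measurable fun x => ∫⁻ y, α x y ∂(Q x) := hα.lintegral_kernel_prod_right
  have h2 : Measurable (Function.uncurry fun (x _ : E) => 1 - ∫⁻ y, α x y ∂(Q x)) :=
    (measurable_const.sub h1).comp measurable_fst
  rw [metropolisKernel, _root_.add_apply, Measure.add_apply, Kernel.withDensity_apply' _ hα,
    Kernel.withDensity_apply _ h2, withDensity_apply _ hA, Kernel.id_apply, setLIntegral_const]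

theorem isMarkovKernel_metropolisKernel {E : Type*} [MeasurableSpace E] (Q : Kernel E E)
    [IsMarkovKernel Q] {α : E → E → ℝ≥0∞} (hα : Measurable (Function.uncurry α))
    (hα1 : ∀ x y, α x y ≤ 1) : IsMarkovKernel (metropolisKernel Q α) := by
  refine ⟨fun x => ⟨?_⟩⟩
  rw [metropolisKernel_apply Q hα x MeasurableSet.univ, setLIntegral_univ, measure_univ, mul_one]
  refine add_tsub_cancel_of_le ?_
  calc ∫⁻ y, α x y ∂(Q x) ≤ ∫⁻ _, 1 ∂(Q x) := lintegral_mono (hα1 x)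
    _ = 1 := by simp

/-- The (unnormalised) target density transferred to the sphere, as a function of `x ∈ ℝ^d`:
`π(x) (R² + ‖x‖²)^d`. -/
def sphereDensity {d : ℕ} (R : ℝ) (π : EuclideanSpace ℝ (Fin d) → ℝ)
    (x : EuclideanSpace ℝ (Fin d)) : ℝ :=
  π x * (R ^ 2 + ‖x‖ ^ 2) ^ d

/-- The acceptance probability
`1 ∧ (π(y) (R² + ‖y‖²)^d) / (π(x) (R² + ‖x‖²)^d)` of a move from `x` to `y`. -/
def accept {d : ℕ} (R : ℝ) (π : EuclideanSpace ℝ (Fin d) → ℝ) (x y : EuclideanSpace ℝ (Fin d)) :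
    ℝ≥0∞ :=
  ENNReal.ofReal (min 1 (sphereDensity R π y / sphereDensity R π x))

/-- The transition kernel on `ℝ^d` of the stereographic projection sampler with radius `R`, step
size `h` and (unnormalised) target density `π`. -/
def spsKernel (d : ℕ) (R h : ℝ) (π : EuclideanSpace ℝ (Fin d) → ℝ) :
    Kernel (EuclideanSpace ℝ (Fin d)) (EuclideanSpace ℝ (Fin d)) :=
  metropolisKernel (proposalKernel d R h) (accept R π)

theorem measurable_accept {d : ℕ} (R : ℝ) {π : EuclideanSpace ℝ (Fin d) → ℝ}
    (hπ : Measurable π) : Measurable (Function.uncurry (accept R π)) := by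
  unfold accept sphereDensity Function.uncurry
  fun_prop

theorem spsKernel_apply {d : ℕ} (R h : ℝ) {π : EuclideanSpace ℝ (Fin d) → ℝ}
    (hπ : Measurable π) (x : EuclideanSpace ℝ (Fin d)) {A : Set (EuclideanSpace ℝ (Fin d))}
    (hA : MeasurableSet A) :
    spsKernel d R h π x A =
      ∫⁻ y in A, accept R π x y ∂((isotropicGaussian (d + 1) h).map (propose R x)) +
        (1 - ∫⁻ y, accept R π x y ∂((isotropicGaussian (d + 1) h).map (propose R x))) *
          Measure.dirac x A := by
  rw [spsKernel, metropolisKernel_apply _ (measurable_accept R hπ) x hA, proposalKernel_apply]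

theorem isMarkovKernel_spsKernel {d : ℕ} (R h : ℝ) {π : EuclideanSpace ℝ (Fin d) → ℝ}
    (hπ : Measurable π) : IsMarkovKernel (spsKernel d R h π) := by
  refine isMarkovKernel_metropolisKernel _ (measurable_accept R hπ) fun x y => ?_
  exact ENNReal.ofReal_le_one.2 (min_le_left _ _)

/-! ### The target distribution and uniform ergodicity -/

/-- The probability distribution on `ℝ^d` whose density is proportional to `π`. -/
def target {d : ℕ} (π : EuclideanSpace ℝ (Fin d) → ℝ) : Measure (EuclideanSpace ℝ (Fin d)) :=
  (∫⁻ x, ENNReal.ofReal (π x))⁻¹ • volume.withDensity (fun x => ENNReal.ofReal (π x))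

/-- Total variation distance of two probability measures: `sup_A |μ(A) - ν(A)|` over measurable
sets `A`. -/
def tvDist {E : Type*} [MeasurableSpace E] (μ ν : Measure E) : ℝ≥0∞ :=
  ⨆ (A : Set E) (_ : MeasurableSet A), ENNReal.ofReal |μ.real A - ν.real A|

/-- A Markov chain with transition kernel `P` is uniformly ergodic, with limit `μ`, if there are
`M < ∞` and `ρ < 1` such that `‖P^n(x, ·) - μ‖_TV ≤ M ρ^n` for all `n` and all starting points
`x`. Here `P ^ n` is the `n`-step transition kernel. -/
def UniformlyErgodic {E : Type*} [MeasurableSpace E] (P : Kernel E E) (μ : Measure E) : Prop :=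
  ∃ M ρ : ℝ, 0 ≤ ρ ∧ ρ < 1 ∧ ∀ (n : ℕ) (x : E), tvDist ((P ^ n) x) μ ≤ ENNReal.ofReal (M * ρ ^ n)

end

end SPS

/-! Moved to the sphere, the proposal depends only on the angle between the current and the proposed
point, so its density there is symmetric. Pulled back to `ℝ^d` it is `(2R)^d / (R² + ‖y‖²)^d` times
a function of `⟪z(x), z(y)⟫`, where `z = stereoInv R` (`map_propose_eq_withDensity`). Write `p(x) =
π(x) (R² + ‖x‖²)^d`. Multiplying the accepted-move density from `x` to `y` by `π(x)` gives `min (p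
x) (p y)` times a symmetric factor, hence reversibility.

Necessity. The proposal density is bounded by an integrable function of `y` that does not depend on
`x`. If `p` is unbounded, pick points where it tends to infinity. Dominated convergence makes the
probability of an accepted move tend to `0` along them (`tendsto_lintegral_moveDensity`). The chain
then stays put for any fixed number `n` of steps with probability tending to `1`, while the target
has no atoms. So the supremum over starting points of the total variation distance is `1` for every
`n`, which excludes a geometric bound.

Sufficiency. If `p ≤ C`, a move to `y` is accepted with probability at least `p(y) / C`. The factor
`(R² + ‖y‖²)^d` cancels, so one step dominates a multiple of the target on any set of points `y`
whose angle to `x` has cosine at least `δ > 0` (`exists_mul_le_spsKernel`). From every `x`, however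
close to the pole, three such moves reach a fixed neighbourhood of the origin (`exists_chain`). This
minorizes the three-step kernel uniformly, and Doeblin's theorem
(`uniformlyErgodic_of_minorization`) concludes. -/

namespace SPS

/-! ### Splitting off the last coordinate; Lebesgue and Gaussian measures -/

/-- The point of `ℝ^(d+1)` with first `d` coordinates `a` and last coordinate `s`. -/
def snocPoint {d : ℕ} (a : EuclideanSpace ℝ (Fin d)) (s : ℝ) : EuclideanSpace ℝ (Fin (d + 1)) :=
  WithLp.toLp 2 (Fin.snoc (α := fun _ => ℝ) (fun i => a i) s)

/-- The first `d` coordinates of a point of `ℝ^(d+1)`. -/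
def initPoint {d : ℕ} (u : EuclideanSpace ℝ (Fin (d + 1))) : EuclideanSpace ℝ (Fin d) :=
  WithLp.toLp 2 fun i => u i.castSucc

@[simp] theorem snocPoint_castSucc {d : ℕ} (a : EuclideanSpace ℝ (Fin d)) (s : ℝ) (i : Fin d) :
    snocPoint a s i.castSucc = a i := by simp [snocPoint]

@[simp] theorem snocPoint_last {d : ℕ} (a : EuclideanSpace ℝ (Fin d)) (s : ℝ) :
    snocPoint a s (Fin.last d) = s := by simp [snocPoint]

theorem smul_snocPoint {d : ℕ} (c : ℝ) (a : EuclideanSpace ℝ (Fin d)) (s : ℝ) :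
    c • snocPoint a s = snocPoint (c • a) (c * s) := by
  ext i
  refine Fin.lastCases ?_ (fun j => ?_) i <;> simp

theorem inner_snocPoint {d : ℕ} (a b : EuclideanSpace ℝ (Fin d)) (s t : ℝ) :
    inner ℝ (snocPoint a s) (snocPoint b t) = inner ℝ a b + s * t := by
  simp only [PiLp.inner_apply, Fin.sum_univ_castSucc, snocPoint_castSucc, snocPoint_last]
  simp [mul_comm]

theorem norm_snocPoint_sq {d : ℕ} (a : EuclideanSpace ℝ (Fin d)) (s : ℝ) :
    ‖snocPoint a s‖ ^ 2 = ‖a‖ ^ 2 + s ^ 2 := by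
  rw [← real_inner_self_eq_norm_sq, inner_snocPoint, real_inner_self_eq_norm_sq]; ring

theorem measurable_snocPoint {d : ℕ} : Measurable
    fun p : EuclideanSpace ℝ (Fin d) × ℝ => snocPoint p.1 p.2 := by
  unfold snocPoint
  refine (WithLp.measurable_toLp 2 _).comp (measurable_pi_lambda _ fun i => ?_)
  refine Fin.lastCases ?_ (fun j => ?_) i
  · simp only [Fin.snoc_last]
    fun_prop
  · simp only [Fin.snoc_castSucc]
    fun_prop

theorem measurable_initPoint {d : ℕ} : Measurable (initPoint (d := d)) := by
  unfold initPoint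
  refine (WithLp.measurable_toLp 2 _).comp (measurable_pi_lambda _ fun i => ?_)
  fun_prop

theorem lintegral_snoc_pi {d : ℕ} (μ : Measure ℝ) [SigmaFinite μ] {G : (Fin (d + 1) → ℝ) → ℝ≥0∞}
    (hG : Measurable G) : ∫⁻ u, G u ∂(Measure.pi fun _ => μ) =
      ∫⁻ a, ∫⁻ s, G (Fin.snoc (α := fun _ => ℝ) a s) ∂μ ∂(Measure.pi fun _ : Fin d => μ) := by
  have hmp := (measurePreserving_piFinSuccAbove (fun _ : Fin (d + 1) => μ) (Fin.last d)).symm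
  have hm : Measurable fun p : ℝ × (Fin d → ℝ) => G (Fin.snoc (α := fun _ => ℝ) p.2 p.1) := by
    convert hG.comp hmp.measurable using 2 with p
    simp [MeasurableEquiv.piFinSuccAbove_symm_apply, Fin.insertNthEquiv]
  rw [← hmp.lintegral_comp hG]
  trans ∫⁻ p : ℝ × (Fin d → ℝ), G (Fin.snoc (α := fun _ => ℝ) p.2 p.1)
      ∂(μ.prod (Measure.pi fun _ => μ))
  · refine lintegral_congr fun p => ?_
    simp [MeasurableEquiv.piFinSuccAbove_symm_apply, Fin.insertNthEquiv]
  · exact lintegral_prod_symm' _ hm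

theorem lintegral_snocPoint {d : ℕ} {G : EuclideanSpace ℝ (Fin (d + 1)) → ℝ≥0∞}
    (hG : Measurable G) :
    ∫⁻ u, G u = ∫⁻ a : EuclideanSpace ℝ (Fin d), ∫⁻ s : ℝ, G (snocPoint a s) := by
  have hm : Measurable fun a : EuclideanSpace ℝ (Fin d) => ∫⁻ s : ℝ, G (snocPoint a s) :=
    (hG.comp measurable_snocPoint).lintegral_prod_right'
  rw [← (PiLp.volume_preserving_toLp (Fin (d + 1))).lintegral_comp hG,
    ← (PiLp.volume_preserving_toLp (Fin d)).lintegral_comp hm]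
  exact lintegral_snoc_pi volume (hG.comp (WithLp.measurable_toLp 2 _))

theorem lintegral_eq_mul_lintegral_smul {d : ℕ} {F : EuclideanSpace ℝ (Fin d) → ℝ≥0∞}
    (hF : Measurable F) {r : ℝ} (hr : 0 < r) :
    ∫⁻ x, F x = ENNReal.ofReal (r ^ d) * ∫⁻ x, F (r • x) := by
  have h1 : ∫⁻ x, F (r • x) = ∫⁻ x, F x ∂(Measure.map (r • ·) volume) :=
    (lintegral_map hF (measurable_const_smul r)).symm
  rw [h1, Measure.map_addHaar_smul _ hr.ne', lintegral_smul_measure, finrank_euclideanSpace_fin,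
    smul_eq_mul, ← mul_assoc, ← ENNReal.ofReal_mul (by positivity), abs_of_pos (by positivity),
    mul_inv_cancel₀ (by positivity), ENNReal.ofReal_one, one_mul]

theorem lintegral_pi_prod {n : ℕ} (μ : Measure ℝ) [SigmaFinite μ] {f : Fin n → ℝ → ℝ≥0∞}
    (hf : ∀ i, Measurable (f i)) :
    ∫⁻ x, ∏ i, f i (x i) ∂(Measure.pi fun _ : Fin n => μ) = ∏ i, ∫⁻ x, f i x ∂μ := by
  induction n with
  | zero => simp
  | succ n ih =>
    rw [lintegral_snoc_pi μ (by fun_prop), Fin.prod_univ_castSucc, ← ih fun i => hf _,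
      ← lintegral_mul_const _ (by fun_prop)]
    refine lintegral_congr fun a => ?_
    simp only [Fin.prod_univ_castSucc, Fin.snoc_castSucc, Fin.snoc_last]
    rw [lintegral_const_mul _ (hf _)]

theorem pi_withDensity_fin {n : ℕ} {f : ℝ → ℝ≥0∞} (hf : Measurable f)
    [SigmaFinite ((volume : Measure ℝ).withDensity f)] :
    Measure.pi (fun _ : Fin n => (volume : Measure ℝ).withDensity f) =
      (volume : Measure (Fin n → ℝ)).withDensity fun x => ∏ i, f (x i) := by
  refine Measure.pi_eq fun s hs => ?_
  rw [withDensity_apply _ (MeasurableSet.univ_pi hs),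
    ← lintegral_indicator (MeasurableSet.univ_pi hs)]
  trans ∫⁻ x : Fin n → ℝ, ∏ i, (s i).indicator f (x i)
  · refine lintegral_congr fun x => ?_
    by_cases hx : x ∈ Set.univ.pi s
    · rw [Set.indicator_of_mem hx]
      exact Finset.prod_congr rfl fun i _ => (Set.indicator_of_mem (hx i trivial) _).symm
    · rw [Set.indicator_of_notMem hx]
      obtain ⟨i, hi⟩ : ∃ i, x i ∉ s i := by simpa using hx
      exact (Finset.prod_eq_zero (Finset.mem_univ i) (Set.indicator_of_notMem hi _)).symm
  · rw [volume_pi, lintegral_pi_prod volume fun i => hf.indicator (hs i)]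
    refine Finset.prod_congr rfl fun i _ => ?_
    rw [lintegral_indicator (hs i), withDensity_apply _ (hs i)]

/-- The density of the standard Gaussian law on `ℝ^d`, as a function of the squared norm. -/
noncomputable def gaussianRadial (d : ℕ) (s : ℝ) : ℝ :=
  (√(2 * Real.pi))⁻¹ ^ d * Real.exp (-s / 2)

theorem gaussianRadial_pos (d : ℕ) (s : ℝ) : 0 < gaussianRadial d s := by
  unfold gaussianRadial; positivity

@[fun_prop] theorem continuous_gaussianRadial (d : ℕ) : Continuous (gaussianRadial d) := by
  unfold gaussianRadial; fun_prop

theorem stdGaussian_eq_withDensity (d : ℕ) : stdGaussian (EuclideanSpace ℝ (Fin d)) =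
    volume.withDensity fun v => ENNReal.ofReal (gaussianRadial d (‖v‖ ^ 2)) := by
  rw [← map_pi_eq_stdGaussian, gaussianReal_of_var_ne_zero 0 one_ne_zero]
  have : SigmaFinite ((volume : Measure ℝ).withDensity (gaussianPDF 0 1)) := by
    rw [← gaussianReal_of_var_ne_zero 0 one_ne_zero]; infer_instance
  rw [pi_withDensity_fin (measurable_gaussianPDF 0 1)]
  ext A hA
  rw [Measure.map_apply (WithLp.measurable_toLp 2 _) hA, withDensity_apply _ hA,
    withDensity_apply _ ((WithLp.measurable_toLp 2 _) hA),
    ← (PiLp.volume_preserving_toLp (Fin d)).setLIntegral_comp_preimage hA (by fun_prop)]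
  refine lintegral_congr fun x => ?_
  simp only [gaussianPDF, gaussianPDFReal, gaussianRadial]
  rw [← ENNReal.ofReal_prod_of_nonneg fun i _ => by positivity]
  rw [Finset.prod_mul_distrib, ← Real.exp_sum, EuclideanSpace.norm_sq_eq]
  simp [Finset.sum_div, neg_div]

theorem stdGaussian_map_initPoint (d : ℕ) :
    (stdGaussian (EuclideanSpace ℝ (Fin (d + 1)))).map initPoint =
      stdGaussian (EuclideanSpace ℝ (Fin d)) := by
  ext A hA
  rw [← map_pi_eq_stdGaussian, ← map_pi_eq_stdGaussian,
    Measure.map_map measurable_initPoint (WithLp.measurable_toLp 2 _),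
    Measure.map_apply (measurable_initPoint.comp (WithLp.measurable_toLp 2 _)) hA,
    Measure.map_apply (WithLp.measurable_toLp 2 _) hA,
    ← lintegral_indicator_one ((measurable_initPoint.comp (WithLp.measurable_toLp 2 _)) hA),
    ← lintegral_indicator_one ((WithLp.measurable_toLp 2 _) hA),
    lintegral_snoc_pi _ (measurable_one.indicator
      ((measurable_initPoint.comp (WithLp.measurable_toLp 2 _)) hA))]
  refine lintegral_congr fun a => ?_
  have : ∀ s : ℝ, ((initPoint ∘ WithLp.toLp 2) ⁻¹' A).indicator (1 : (Fin (d + 1) → ℝ) → ℝ≥0∞)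
      (Fin.snoc (α := fun _ => ℝ) a s) = (WithLp.toLp 2 ⁻¹' A).indicator 1 a := fun s => by
    have hi : initPoint (WithLp.toLp 2 (Fin.snoc (α := fun _ => ℝ) a s)) = WithLp.toLp 2 a := by
      ext i
      simp [initPoint]
    change A.indicator (fun _ => (1 : ℝ≥0∞))
      (initPoint (WithLp.toLp 2 (Fin.snoc (α := fun _ => ℝ) a s))) =
        A.indicator (fun _ => 1) (WithLp.toLp 2 a)
    rw [hi]
  simp [this]

/-! ### Stereographic polar coordinates -/

theorem stereoInv_eq {d : ℕ} (R : ℝ) (x : EuclideanSpace ℝ (Fin d)) :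
    stereoInv R x = snocPoint ((2 * R / (‖x‖ ^ 2 + R ^ 2)) • x)
      ((‖x‖ ^ 2 - R ^ 2) / (‖x‖ ^ 2 + R ^ 2)) := by
  ext i
  refine Fin.lastCases ?_ (fun j => ?_) i
  · simp [stereoInv]
  · simp only [stereoInv, Fin.snoc_castSucc, snocPoint_castSucc, PiLp.smul_apply, smul_eq_mul]
    ring

theorem smul_stereoInv {d : ℕ} {R : ℝ} (hR : 0 < R) (x : EuclideanSpace ℝ (Fin d)) (t : ℝ) :
    (t * (R ^ 2 + ‖x‖ ^ 2)) • stereoInv R x =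
      snocPoint ((2 * R * t) • x) (t * (‖x‖ ^ 2 - R ^ 2)) := by
  have : ‖x‖ ^ 2 + R ^ 2 ≠ 0 := by positivity
  rw [stereoInv_eq, smul_snocPoint, smul_smul]
  refine congrArg₂ snocPoint (congrArg (· • x) ?_) ?_
  · field_simp
    ring
  · field_simp
    ring

/-- The substitution `s = b / t - c * t` is a decreasing bijection from `(0, ∞)` onto `ℝ`. With `b =
‖a‖² / (4R²)` and `c = R²` it recovers the last coordinate of a point from its first coordinates `a`
and the polar parameter `t`. -/
theorem lintegral_eq_setLIntegral_Ioi {b c : ℝ} (hb : 0 < b) (hc : 0 < c) (g : ℝ → ℝ≥0∞) :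
    ∫⁻ s, g s = ∫⁻ t in Set.Ioi 0, ENNReal.ofReal (b / t ^ 2 + c) * g (b / t - c * t) := by
  have himg : (fun t : ℝ => b / t - c * t) '' Set.Ioi 0 = Set.univ := by
    refine Set.eq_univ_of_forall fun s => ?_
    have hD : 0 < s ^ 2 + 4 * b * c := by positivity
    have hlt : s < √(s ^ 2 + 4 * b * c) := by
      refine lt_of_abs_lt ?_
      rw [← Real.sqrt_sq_eq_abs]
      exact Real.sqrt_lt_sqrt (sq_nonneg s) (by nlinarith [mul_pos hb hc])
    have hpos : 0 < √(s ^ 2 + 4 * b * c) - s := by linarith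
    -- The positive root of `c t² + s t - b = 0`.
    refine ⟨(√(s ^ 2 + 4 * b * c) - s) / (2 * c), by simp only [Set.mem_Ioi]; positivity, ?_⟩
    have hs := Real.sq_sqrt hD.le
    set q := √(s ^ 2 + 4 * b * c)
    field_simp
    nlinarith
  have hinj : Set.InjOn (fun t : ℝ => b / t - c * t) (Set.Ioi 0) := by
    have : StrictAntiOn (fun t : ℝ => b / t - c * t) (Set.Ioi 0) := fun x hx y hy hxy => by
      have h1 : b / y < b / x := div_lt_div_of_pos_left hb hx hxy
      have h2 : c * x < c * y := mul_lt_mul_of_pos_left hxy hc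
      change b / y - c * y < b / x - c * x
      linarith
    exact this.injOn
  have hder : ∀ t ∈ Set.Ioi (0 : ℝ), HasDerivWithinAt (fun t : ℝ => b / t - c * t)
      (-(b / t ^ 2 + c)) (Set.Ioi 0) t := fun t ht => by
    have h1 := ((hasDerivAt_inv (ne_of_gt ht)).const_mul b).sub ((hasDerivAt_id t).const_mul c)
    refine (h1.congr_deriv ?_).hasDerivWithinAt
    field_simp
    ring
  rw [← setLIntegral_univ, ← himg,
    lintegral_image_eq_lintegral_abs_deriv_mul measurableSet_Ioi hder hinj]
  refine setLIntegral_congr_fun measurableSet_Ioi fun t ht => ?_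
  have ht : 0 < t := ht
  rw [abs_neg, abs_of_pos (by positivity)]

/-- Polar coordinates on `ℝ^(d+1)` with the directions parametrised by stereographic
projection. -/
theorem lintegral_stereoInv_polar {d : ℕ} (hd : 0 < d) {R : ℝ} (hR : 0 < R)
    {G : EuclideanSpace ℝ (Fin (d + 1)) → ℝ≥0∞} (hG : Measurable G) :
    ∫⁻ u, G u = ∫⁻ x : EuclideanSpace ℝ (Fin d), ∫⁻ t in Set.Ioi (0 : ℝ),
      ENNReal.ofReal ((2 * R * t) ^ d * (R ^ 2 + ‖x‖ ^ 2)) *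
        G ((t * (R ^ 2 + ‖x‖ ^ 2)) • stereoInv R x) := by
  have : Nonempty (Fin d) := ⟨⟨0, hd⟩⟩
  have : Nontrivial (EuclideanSpace ℝ (Fin d)) := inferInstance
  -- At `a = 0` the substitution degenerates, since `b a = 0`. This null set contains the ray
  -- through the pole, which the parametrisation misses.
  have hae : ∀ᵐ a : EuclideanSpace ℝ (Fin d), a ≠ 0 := by
    simp [ae_iff]
  have hm := measurable_snocPoint (d := d)
  let b (a : EuclideanSpace ℝ (Fin d)) : ℝ := ‖a‖ ^ 2 / (4 * R ^ 2)
  calc ∫⁻ u, G u = ∫⁻ a : EuclideanSpace ℝ (Fin d), ∫⁻ s : ℝ, G (snocPoint a s) :=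
        lintegral_snocPoint hG
    _ = ∫⁻ a : EuclideanSpace ℝ (Fin d), ∫⁻ t in Set.Ioi (0 : ℝ),
          ENNReal.ofReal (b a / t ^ 2 + R ^ 2) * G (snocPoint a (b a / t - R ^ 2 * t)) := by
        refine lintegral_congr_ae ?_
        filter_upwards [hae] with a ha
        have : 0 < ‖a‖ := norm_pos_iff.2 ha
        exact lintegral_eq_setLIntegral_Ioi (by positivity) (by positivity) fun s =>
          G (snocPoint a s)
    _ = ∫⁻ t in Set.Ioi (0 : ℝ), ∫⁻ a : EuclideanSpace ℝ (Fin d),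
          ENNReal.ofReal (b a / t ^ 2 + R ^ 2) * G (snocPoint a (b a / t - R ^ 2 * t)) := by
        refine lintegral_lintegral_swap (Measurable.aemeasurable ?_)
        refine Measurable.mul (by fun_prop) (hG.comp (hm.comp (f := fun p :
          EuclideanSpace ℝ (Fin d) × ℝ => (p.1, b p.1 / p.2 - R ^ 2 * p.2)) ?_))
        fun_prop
    _ = ∫⁻ t in Set.Ioi (0 : ℝ), ∫⁻ x : EuclideanSpace ℝ (Fin d),
          ENNReal.ofReal ((2 * R * t) ^ d * (R ^ 2 + ‖x‖ ^ 2)) *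
            G ((t * (R ^ 2 + ‖x‖ ^ 2)) • stereoInv R x) := by
        refine setLIntegral_congr_fun measurableSet_Ioi fun t ht => ?_
        have ht : 0 < t := ht
        have hr : 0 < 2 * R * t := by positivity
        -- For fixed `t`, rescale `a = 2 R t x`; this produces the factor `(2 R t)^d` of the
        -- Jacobian.
        rw [lintegral_eq_mul_lintegral_smul _ hr, ← lintegral_const_mul]
        · refine lintegral_congr fun x => ?_
          have hb : b ((2 * R * t) • x) = t ^ 2 * ‖x‖ ^ 2 := by
            simp only [b]
            rw [norm_smul, Real.norm_of_nonneg hr.le]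
            field_simp
            ring
          have h1 : t ^ 2 * ‖x‖ ^ 2 / t ^ 2 + R ^ 2 = R ^ 2 + ‖x‖ ^ 2 := by
            field_simp
            ring
          have h2 : t ^ 2 * ‖x‖ ^ 2 / t - R ^ 2 * t = t * (‖x‖ ^ 2 - R ^ 2) := by
            field_simp
          rw [smul_stereoInv hR, ENNReal.ofReal_mul (by positivity),
            mul_assoc (ENNReal.ofReal _), hb, h1, h2]
        · refine Measurable.mul (by fun_prop) (hG.comp (hm.comp (f := fun x :
            EuclideanSpace ℝ (Fin d) => ((2 * R * t) • x,
              b ((2 * R * t) • x) / t - R ^ 2 * t)) ?_))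
          fun_prop
        · refine Measurable.mul (by fun_prop) (hG.comp (hm.comp (f := fun x :
            EuclideanSpace ℝ (Fin d) => (x, b x / t - R ^ 2 * t)) ?_))
          fun_prop
    _ = _ := by
        refine lintegral_lintegral_swap (Measurable.aemeasurable ?_)
        have := measurable_stereoInv (d := d) R
        have h2 : Measurable fun p : ℝ × EuclideanSpace ℝ (Fin d) =>
          (p.1 * (R ^ 2 + ‖p.2‖ ^ 2)) • stereoInv R p.2 := by fun_prop
        exact Measurable.mul (by fun_prop) (hG.comp h2)

theorem inner_stereoInv {d : ℕ} {R : ℝ} (hR : 0 < R) (x y : EuclideanSpace ℝ (Fin d)) :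
    inner ℝ (stereoInv R x) (stereoInv R y) =
      (4 * R ^ 2 * inner ℝ x y + (‖x‖ ^ 2 - R ^ 2) * (‖y‖ ^ 2 - R ^ 2)) /
        ((‖x‖ ^ 2 + R ^ 2) * (‖y‖ ^ 2 + R ^ 2)) := by
  rw [stereoInv_eq, stereoInv_eq, inner_snocPoint, real_inner_smul_left, real_inner_smul_right]
  have h1 : ‖x‖ ^ 2 + R ^ 2 ≠ 0 := by positivity
  have h2 : ‖y‖ ^ 2 + R ^ 2 ≠ 0 := by positivity
  field_simp
  ring

theorem norm_stereoInv {d : ℕ} {R : ℝ} (hR : 0 < R) (x : EuclideanSpace ℝ (Fin d)) :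
    ‖stereoInv R x‖ = 1 := by
  have h1 : ‖x‖ ^ 2 + R ^ 2 ≠ 0 := by positivity
  have h2 : ‖stereoInv R x‖ ^ 2 = 1 := by
    rw [← real_inner_self_eq_norm_sq, inner_stereoInv hR, real_inner_self_eq_norm_sq]
    field_simp
    ring
  exact (pow_eq_one_iff_of_nonneg (norm_nonneg _) two_ne_zero).1 h2

theorem inner_stereoInv_le_one {d : ℕ} {R : ℝ} (hR : 0 < R) (x y : EuclideanSpace ℝ (Fin d)) :
    inner ℝ (stereoInv R x) (stereoInv R y) ≤ 1 := by
  simpa [norm_stereoInv hR] using real_inner_le_norm (stereoInv R x) (stereoInv R y)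

theorem stereo_stereoInv {d : ℕ} {R : ℝ} (hR : 0 < R) (x : EuclideanSpace ℝ (Fin d)) :
    stereo R (stereoInv R x) = x := by
  have h1 : ‖x‖ ^ 2 + R ^ 2 ≠ 0 := by positivity
  have h2 : 1 - (‖x‖ ^ 2 - R ^ 2) / (‖x‖ ^ 2 + R ^ 2) = 2 * R ^ 2 / (‖x‖ ^ 2 + R ^ 2) := by
    field_simp
    ring
  ext i
  simp only [stereo, stereoInv_eq, snocPoint_castSucc, snocPoint_last, h2, PiLp.smul_apply,
    smul_eq_mul]
  field_simp

/-! ### The density of the proposal -/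

/-- The density of the proposal on the sphere, up to a constant, as a function of the cosine `c` of
the angle between the current point and the proposed one. -/
noncomputable def proposalProfile (d : ℕ) (h c : ℝ) : ℝ :=
  if 0 < c then gaussianRadial d ((1 / c ^ 2 - 1) / h ^ 2) / (h ^ d * c ^ (d + 1)) else 0

/-- The density of the law of the proposal from `x`. -/
noncomputable def proposalDensity {d : ℕ} (R h : ℝ) (x y : EuclideanSpace ℝ (Fin d)) : ℝ :=
  (2 * R) ^ d / (R ^ 2 + ‖y‖ ^ 2) ^ d *
    proposalProfile d h (inner ℝ (stereoInv R x) (stereoInv R y))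

theorem measurable_proposalProfile (d : ℕ) (h : ℝ) : Measurable (proposalProfile d h) := by
  unfold proposalProfile
  refine Measurable.ite measurableSet_Ioi ?_ measurable_const
  fun_prop

theorem measurable_proposalDensity {d : ℕ} (R h : ℝ) :
    Measurable (Function.uncurry (proposalDensity (d := d) R h)) := by
  have h1 := measurable_stereoInv (d := d) R
  have h2 : Measurable fun p : EuclideanSpace ℝ (Fin d) × EuclideanSpace ℝ (Fin d) =>
      proposalProfile d h (inner ℝ (stereoInv R p.1) (stereoInv R p.2)) :=
    (measurable_proposalProfile d h).comp (by fun_prop)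
  unfold proposalDensity Function.uncurry
  fun_prop

theorem proposalProfile_nonneg (d : ℕ) {h : ℝ} (hh : 0 < h) (c : ℝ) :
    0 ≤ proposalProfile d h c := by
  have := gaussianRadial_pos d ((1 / c ^ 2 - 1) / h ^ 2)
  unfold proposalProfile
  split_ifs <;> positivity

/-- The projection to `ℝ^d` of the direction of a nonzero vector of `ℝ^(d+1)`. -/
noncomputable def stereoDir {d : ℕ} (R : ℝ) (u : EuclideanSpace ℝ (Fin (d + 1))) :
    EuclideanSpace ℝ (Fin d) :=
  stereo R (‖u‖⁻¹ • u)

theorem measurable_stereoDir {d : ℕ} (R : ℝ) : Measurable (stereoDir (d := d) R) :=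
  (measurable_stereo R).comp (by fun_prop)

theorem stereoDir_smul {d : ℕ} (R : ℝ) {t : ℝ} (ht : 0 < t) (u : EuclideanSpace ℝ (Fin (d + 1))) :
    stereoDir R (t • u) = stereoDir R u := by
  unfold stereoDir
  rw [norm_smul, Real.norm_of_nonneg ht.le, smul_smul, mul_inv, mul_right_comm,
    inv_mul_cancel₀ ht.ne', one_mul]

/-- Reflect in the hyperplane orthogonal to `v - w`. -/
theorem exists_linearIsometryEquiv_apply_eq {F : Type*} [NormedAddCommGroup F]
    [InnerProductSpace ℝ F] {v w : F} (hvw : ‖v‖ = ‖w‖) : ∃ O : F ≃ₗᵢ[ℝ] F, O v = w :=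
  ⟨(ℝ ∙ (v - w))ᗮ.reflection, Submodule.reflection_sub hvw⟩

/-- After a rotation taking the pole to the current point, the affine tangent plane becomes the
plane of height `1`. The normal component of the increment is discarded, so only `d` Gaussian
coordinates remain. -/
theorem propose_smul_isometry {d : ℕ} {R : ℝ} (hR : 0 < R) (h : ℝ) (x : EuclideanSpace ℝ (Fin d))
    {O : EuclideanSpace ℝ (Fin (d + 1)) ≃ₗᵢ[ℝ] EuclideanSpace ℝ (Fin (d + 1))}
    (hO : O (snocPoint 0 1) = stereoInv R x) (w : EuclideanSpace ℝ (Fin (d + 1))) :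
    propose R x (h • O w) = stereoDir R (O (snocPoint (h • initPoint w) 1)) := by
  have hw : w = snocPoint (initPoint w) (w (Fin.last d)) := by
    ext i
    refine Fin.lastCases ?_ (fun j => ?_) i <;> simp [initPoint]
  have key : stereoInv R x + tangentPart (stereoInv R x) (h • O w) =
      O (snocPoint (h • initPoint w) 1) := by
    unfold tangentPart
    rw [norm_stereoInv hR, ← hO, real_inner_smul_right, O.inner_map_map, ← map_smul, ← map_smul,
      ← map_sub, ← map_add]
    congr 1
    conv_lhs => rw [hw]
    rw [inner_snocPoint]
    ext i
    refine Fin.lastCases ?_ (fun j => ?_) i <;> simp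
  unfold propose spherePropose stereoDir
  rw [key]

theorem lintegral_propose_eq_gaussian {d : ℕ} {R : ℝ} (hR : 0 < R) (h : ℝ)
    (x : EuclideanSpace ℝ (Fin d))
    {O : EuclideanSpace ℝ (Fin (d + 1)) ≃ₗᵢ[ℝ] EuclideanSpace ℝ (Fin (d + 1))}
    (hO : O (snocPoint 0 1) = stereoInv R x) {F : EuclideanSpace ℝ (Fin d) → ℝ≥0∞}
    (hF : Measurable F) :
    ∫⁻ w, F (propose R x w) ∂(isotropicGaussian (d + 1) h) =
      ∫⁻ v : EuclideanSpace ℝ (Fin d), ENNReal.ofReal (gaussianRadial d (‖v‖ ^ 2)) *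
        F (stereoDir R (O (snocPoint (h • v) 1))) := by
  have hp : Measurable (propose R x) := (measurable_propose R).of_uncurry_left
  have hOm : Measurable O := O.continuous.measurable
  have hs : Measurable fun v : EuclideanSpace ℝ (Fin d) => snocPoint (h • v) 1 :=
    measurable_snocPoint.comp (f := fun v : EuclideanSpace ℝ (Fin d) => (h • v, (1 : ℝ)))
      (by fun_prop)
  have hD : Measurable fun v : EuclideanSpace ℝ (Fin d) =>
      F (stereoDir R (O (snocPoint (h • v) 1))) :=
    hF.comp ((measurable_stereoDir R).comp (hOm.comp hs))
  have hi := measurable_initPoint (d := d)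
  have hFp : Measurable fun w => F (propose R x w) := hF.comp hp
  have hFh : Measurable fun w => F (propose R x (h • w)) := hFp.comp (measurable_const_smul h)
  rw [isotropicGaussian, lintegral_map hFp (by fun_prop), ← stdGaussian_map O,
    lintegral_map hFh hOm]
  simp only [propose_smul_isometry hR h x hO]
  rw [← lintegral_map hD hi, stdGaussian_map_initPoint, stdGaussian_eq_withDensity,
    lintegral_withDensity_eq_lintegral_mul _ (by fun_prop) hD]
  rfl

/-- The density, at a point `u` with scalar product `s` with the current point, of a random vector
in the direction of the proposal. -/
noncomputable def coneDensity (d : ℕ) (h : ℝ) (u : EuclideanSpace ℝ (Fin (d + 1))) (s : ℝ) : ℝ≥0∞ :=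
  (Set.Ioc 0 1).indicator (fun s => ENNReal.ofReal
    (((h * s) ^ d)⁻¹ * gaussianRadial d ((‖u‖ ^ 2 - s ^ 2) / (h * s) ^ 2))) s

theorem measurable_coneDensity (d : ℕ) (h : ℝ) :
    Measurable fun p : EuclideanSpace ℝ (Fin (d + 1)) × ℝ => coneDensity d h p.1 p.2 := by
  have h1 : (fun p : EuclideanSpace ℝ (Fin (d + 1)) × ℝ => coneDensity d h p.1 p.2) =
      (Prod.snd ⁻¹' Set.Ioc (0 : ℝ) 1).indicator fun p => ENNReal.ofReal
        (((h * p.2) ^ d)⁻¹ * gaussianRadial d ((‖p.1‖ ^ 2 - p.2 ^ 2) / (h * p.2) ^ 2)) := by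
    funext p
    simp [coneDensity, Set.indicator]
  rw [h1]
  exact Measurable.indicator (by fun_prop) (measurable_snd measurableSet_Ioc)

/-- The Gaussian lives on a hyperplane, but only the direction of its points matters. Multiplying by
an independent scalar uniform on `(0, 1]` therefore changes nothing, and spreads the law over a cone
in `ℝ^(d+1)`, where it has a Lebesgue density to which polar coordinates apply. -/
theorem lintegral_gaussian_eq_cone {d : ℕ} (R : ℝ) {h : ℝ} (hh : 0 < h)
    {z : EuclideanSpace ℝ (Fin (d + 1))}
    {O : EuclideanSpace ℝ (Fin (d + 1)) ≃ₗᵢ[ℝ] EuclideanSpace ℝ (Fin (d + 1))}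
    (hO : O (snocPoint 0 1) = z) {F : EuclideanSpace ℝ (Fin d) → ℝ≥0∞} (hF : Measurable F) :
    ∫⁻ v : EuclideanSpace ℝ (Fin d), ENNReal.ofReal (gaussianRadial d (‖v‖ ^ 2)) *
        F (stereoDir R (O (snocPoint (h • v) 1))) =
      ∫⁻ u, coneDensity d h u (inner ℝ z u) * F (stereoDir R u) := by
  have hOm : Measurable O := O.continuous.measurable
  have hFm : Measurable fun u => F (stereoDir R u) := hF.comp (measurable_stereoDir R)
  have hW : Measurable fun u => coneDensity d h u (inner ℝ z u) * F (stereoDir R u) :=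
    ((measurable_coneDensity d h).comp (f := fun u => (u, inner ℝ z u)) (by fun_prop)).mul hFm
  have hlast : ∀ (a : EuclideanSpace ℝ (Fin d)) (t : ℝ), inner ℝ z (O (snocPoint a t)) = t := by
    intro a t
    rw [← hO, O.inner_map_map, inner_snocPoint]
    simp
  have hnorm : ∀ (a : EuclideanSpace ℝ (Fin d)) (t : ℝ),
      ‖O (snocPoint a t)‖ ^ 2 - t ^ 2 = ‖a‖ ^ 2 := by
    intro a t
    rw [O.norm_map, norm_snocPoint_sq]
    ring
  set J := ∫⁻ v : EuclideanSpace ℝ (Fin d), ENNReal.ofReal (gaussianRadial d (‖v‖ ^ 2)) *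
        F (stereoDir R (O (snocPoint (h • v) 1))) with hJ
  -- The slice at height `t` is the slice at height `1` dilated by `t`, and `stereoDir` is invariant
  -- under dilation.
  have hslice : ∀ t ∈ Set.Ioc (0 : ℝ) 1, J = ∫⁻ a : EuclideanSpace ℝ (Fin d),
      coneDensity d h (O (snocPoint a t)) t * F (stereoDir R (O (snocPoint a t))) := by
    intro t ht
    have ht0 : 0 < t := ht.1
    have hr : 0 < h * t := mul_pos hh ht0
    have hs : Measurable fun a : EuclideanSpace ℝ (Fin d) => O (snocPoint a t) :=
      hOm.comp (measurable_snocPoint.comp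
        (f := fun a : EuclideanSpace ℝ (Fin d) => (a, t)) (by fun_prop))
    have hm : Measurable fun a : EuclideanSpace ℝ (Fin d) =>
        coneDensity d h (O (snocPoint a t)) t * F (stereoDir R (O (snocPoint a t))) :=
      ((measurable_coneDensity d h).comp (hs.prodMk measurable_const)).mul (hFm.comp hs)
    have hmr : Measurable fun v : EuclideanSpace ℝ (Fin d) =>
        coneDensity d h (O (snocPoint ((h * t) • v) t)) t *
          F (stereoDir R (O (snocPoint ((h * t) • v) t))) :=
      hm.comp (measurable_const_smul (h * t))
    rw [lintegral_eq_mul_lintegral_smul hm hr, ← lintegral_const_mul _ hmr, hJ]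
    refine lintegral_congr fun v => ?_
    have h1 : snocPoint ((h * t) • v) t = t • snocPoint (h • v) 1 := by
      rw [smul_snocPoint, smul_smul, mul_comm h t, mul_one]
    have h2 : coneDensity d h (O (snocPoint ((h * t) • v) t)) t =
        ENNReal.ofReal (((h * t) ^ d)⁻¹ * gaussianRadial d (‖v‖ ^ 2)) := by
      rw [coneDensity, Set.indicator_of_mem ht, hnorm, norm_smul, Real.norm_of_nonneg hr.le,
        mul_pow (h * t) ‖v‖, mul_div_cancel_left₀ (‖v‖ ^ 2) (pow_pos hr 2).ne']
    rw [h2, h1, map_smul, stereoDir_smul R ht0, ← mul_assoc, ← ENNReal.ofReal_mul (by positivity),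
      ← mul_assoc, mul_inv_cancel₀ (by positivity), one_mul]
  -- The interval has length `1`, so averaging over heights returns `J`.
  calc J = ∫⁻ _ in Set.Ioc (0 : ℝ) 1, J := by simp
    _ = ∫⁻ t in Set.Ioc (0 : ℝ) 1, ∫⁻ a : EuclideanSpace ℝ (Fin d),
          coneDensity d h (O (snocPoint a t)) t * F (stereoDir R (O (snocPoint a t))) :=
        setLIntegral_congr_fun measurableSet_Ioc hslice
    _ = ∫⁻ t : ℝ, ∫⁻ a : EuclideanSpace ℝ (Fin d),
          coneDensity d h (O (snocPoint a t)) t * F (stereoDir R (O (snocPoint a t))) := by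
        rw [← lintegral_indicator measurableSet_Ioc]
        refine lintegral_congr fun t => ?_
        by_cases ht : t ∈ Set.Ioc (0 : ℝ) 1
        · rw [Set.indicator_of_mem ht]
        · simp [coneDensity, Set.indicator_of_notMem ht]
    _ = ∫⁻ a : EuclideanSpace ℝ (Fin d), ∫⁻ t : ℝ,
          coneDensity d h (O (snocPoint a t)) t * F (stereoDir R (O (snocPoint a t))) := by
        refine lintegral_lintegral_swap (Measurable.aemeasurable ?_)
        have hs : Measurable fun p : ℝ × EuclideanSpace ℝ (Fin d) => O (snocPoint p.2 p.1) :=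
          hOm.comp (measurable_snocPoint.comp measurable_swap)
        exact ((measurable_coneDensity d h).comp (hs.prodMk measurable_fst)).mul (hFm.comp hs)
    _ = ∫⁻ u, coneDensity d h (O u) (inner ℝ z (O u)) * F (stereoDir R (O u)) := by
        have hWO : Measurable fun u =>
          coneDensity d h (O u) (inner ℝ z (O u)) * F (stereoDir R (O u)) := hW.comp hOm
        rw [lintegral_snocPoint hWO]
        simp only [hlast]
    _ = _ := O.measurePreserving.lintegral_comp hW

theorem setLIntegral_coneDensity {d : ℕ} {R : ℝ} (hR : 0 < R) {h : ℝ} (hh : 0 < h)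
    (x y : EuclideanSpace ℝ (Fin d)) :
    ∫⁻ t in Set.Ioi (0 : ℝ), ENNReal.ofReal ((2 * R * t) ^ d * (R ^ 2 + ‖y‖ ^ 2)) *
        coneDensity d h ((t * (R ^ 2 + ‖y‖ ^ 2)) • stereoInv R y)
          (inner ℝ (stereoInv R x) ((t * (R ^ 2 + ‖y‖ ^ 2)) • stereoInv R y)) =
      ENNReal.ofReal (proposalDensity R h x y) := by
  have hn : 0 < R ^ 2 + ‖y‖ ^ 2 := by positivity
  unfold proposalDensity proposalProfile coneDensity
  simp only [real_inner_smul_right, norm_smul, norm_stereoInv hR, mul_one]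
  set n := R ^ 2 + ‖y‖ ^ 2
  set c : ℝ := inner ℝ (stereoInv R x) (stereoInv R y)
  split_ifs with hc
  · set C := (2 * R) ^ d / (h ^ d * n ^ d * c ^ d) * n * gaussianRadial d ((1 / c ^ 2 - 1) / h ^ 2)
    have hC : 0 ≤ C := by
      have := gaussianRadial_pos d ((1 / c ^ 2 - 1) / h ^ 2)
      positivity
    have hnc : 0 < n * c := mul_pos hn hc
    -- The factor `t^d` of the Jacobian cancels the one in the cone density, and the Gaussian
    -- argument does not depend on `t`. The integrand is thus constant up to the cutoff where the
    -- height `t * n * c` reaches `1`.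
    trans ∫⁻ t in Set.Ioi (0 : ℝ), (Set.Iic (1 / (n * c))).indicator (fun _ => ENNReal.ofReal C) t
    · refine setLIntegral_congr_fun measurableSet_Ioi fun t ht => ?_
      have ht : 0 < t := ht
      have hiff : t * n * c ∈ Set.Ioc (0 : ℝ) 1 ↔ t ∈ Set.Iic (1 / (n * c)) := by
        rw [Set.mem_Ioc, Set.mem_Iic, le_div_iff₀ hnc, ← mul_assoc]
        exact and_iff_right (by positivity)
      by_cases hm : t ∈ Set.Iic (1 / (n * c))
      · simp only [Set.indicator_of_mem hm, Set.indicator_of_mem (hiff.2 hm)]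
        rw [← ENNReal.ofReal_mul (by positivity)]
        have harg : (‖t * n‖ ^ 2 - (t * n * c) ^ 2) / (h * (t * n * c)) ^ 2 =
            (1 / c ^ 2 - 1) / h ^ 2 := by
          rw [Real.norm_of_nonneg (by positivity)]
          field_simp
        rw [harg]
        congr 1
        simp only [C, mul_pow]
        field_simp
      · simp only [Set.indicator_of_notMem hm, Set.indicator_of_notMem (mt hiff.1 hm), mul_zero]
    · rw [lintegral_indicator measurableSet_Iic, setLIntegral_const,
        Measure.restrict_apply measurableSet_Iic, Set.Iic_inter_Ioi, Real.volume_Ioc, sub_zero,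
        ← ENNReal.ofReal_mul hC]
      congr 1
      simp only [C, pow_succ]
      field_simp
  · rw [mul_zero, ENNReal.ofReal_zero]
    refine setLIntegral_eq_zero measurableSet_Ioi fun t ht => ?_
    have ht : 0 < t := ht
    have : t * n * c ∉ Set.Ioc (0 : ℝ) 1 := fun hm =>
      absurd hm.1 (not_lt.2 (mul_nonpos_of_nonneg_of_nonpos (by positivity) (not_lt.1 hc)))
    simp [Set.indicator_of_notMem this]

theorem lintegral_propose {d : ℕ} (hd : 0 < d) {R : ℝ} (hR : 0 < R) {h : ℝ} (hh : 0 < h)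
    (x : EuclideanSpace ℝ (Fin d)) {F : EuclideanSpace ℝ (Fin d) → ℝ≥0∞} (hF : Measurable F) :
    ∫⁻ w, F (propose R x w) ∂(isotropicGaussian (d + 1) h) =
      ∫⁻ y, ENNReal.ofReal (proposalDensity R h x y) * F y := by
  obtain ⟨O, hO⟩ : ∃ O : EuclideanSpace ℝ (Fin (d + 1)) ≃ₗᵢ[ℝ] EuclideanSpace ℝ (Fin (d + 1)),
      O (snocPoint 0 1) = stereoInv R x := by
    refine exists_linearIsometryEquiv_apply_eq ?_
    rw [norm_stereoInv hR, ← Real.sqrt_sq (norm_nonneg _), norm_snocPoint_sq]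
    simp
  have hW : Measurable fun u =>
      coneDensity d h u (inner ℝ (stereoInv R x) u) * F (stereoDir R u) :=
    ((measurable_coneDensity d h).comp (f := fun u => (u, inner ℝ (stereoInv R x) u))
      (by fun_prop)).mul (hF.comp (measurable_stereoDir R))
  rw [lintegral_propose_eq_gaussian hR h x hO hF, lintegral_gaussian_eq_cone R hh hO hF,
    lintegral_stereoInv_polar hd hR hW]
  refine lintegral_congr fun y => ?_
  have hdir : ∀ t ∈ Set.Ioi (0 : ℝ),
      stereoDir R ((t * (R ^ 2 + ‖y‖ ^ 2)) • stereoInv R y) = y := fun t ht => by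
    have ht : 0 < t := ht
    rw [stereoDir_smul R (by positivity), stereoDir, norm_stereoInv hR, inv_one, one_smul,
      stereo_stereoInv hR]
  have hmt : Measurable fun t : ℝ => ENNReal.ofReal ((2 * R * t) ^ d * (R ^ 2 + ‖y‖ ^ 2)) *
      coneDensity d h ((t * (R ^ 2 + ‖y‖ ^ 2)) • stereoInv R y)
        (inner ℝ (stereoInv R x) ((t * (R ^ 2 + ‖y‖ ^ 2)) • stereoInv R y)) :=
    Measurable.mul (by fun_prop) ((measurable_coneDensity d h).comp
      (f := fun t : ℝ => ((t * (R ^ 2 + ‖y‖ ^ 2)) • stereoInv R y,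
        inner ℝ (stereoInv R x) ((t * (R ^ 2 + ‖y‖ ^ 2)) • stereoInv R y))) (by fun_prop))
  rw [← setLIntegral_coneDensity hR hh, ← lintegral_mul_const _ hmt]
  refine setLIntegral_congr_fun measurableSet_Ioi fun t ht => ?_
  simp only [hdir t ht, mul_assoc]

/-- The proposal from `x` has density `proposalDensity R h x`. -/
theorem map_propose_eq_withDensity {d : ℕ} (hd : 0 < d) {R : ℝ} (hR : 0 < R) {h : ℝ} (hh : 0 < h)
    (x : EuclideanSpace ℝ (Fin d)) :
    (isotropicGaussian (d + 1) h).map (propose R x) =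
      volume.withDensity fun y => ENNReal.ofReal (proposalDensity R h x y) := by
  have hp : Measurable (propose R x) := (measurable_propose R).of_uncurry_left
  have hq : Measurable (proposalDensity R h x) := (measurable_proposalDensity R h).of_uncurry_left
  refine Measure.ext_of_lintegral _ fun F hF => ?_
  rw [lintegral_map hF hp, lintegral_propose hd hR hh x hF,
    lintegral_withDensity_eq_lintegral_mul _ (by fun_prop) hF]
  rfl

/-! ### Accepted moves, reversibility and the target -/

theorem sphereDensity_pos {d : ℕ} {R : ℝ} (hR : 0 < R) {π : EuclideanSpace ℝ (Fin d) → ℝ}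
    (hπ_pos : ∀ x, 0 < π x) (x : EuclideanSpace ℝ (Fin d)) : 0 < sphereDensity R π x := by
  have := hπ_pos x
  unfold sphereDensity
  positivity

/-- The density of the law of an accepted move from `x`. -/
noncomputable def moveDensity {d : ℕ} (R h : ℝ) (π : EuclideanSpace ℝ (Fin d) → ℝ)
    (x y : EuclideanSpace ℝ (Fin d)) : ℝ :=
  min 1 (sphereDensity R π y / sphereDensity R π x) * proposalDensity R h x y

theorem measurable_moveDensity {d : ℕ} (R h : ℝ) {π : EuclideanSpace ℝ (Fin d) → ℝ}
    (hπ : Measurable π) : Measurable (Function.uncurry (moveDensity R h π)) := by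
  have hq := measurable_proposalDensity (d := d) R h
  unfold moveDensity sphereDensity Function.uncurry
  unfold Function.uncurry at hq
  fun_prop

theorem spsKernel_apply_eq_moveDensity {d : ℕ} (hd : 0 < d) {R : ℝ} (hR : 0 < R) {h : ℝ}
    (hh : 0 < h) {π : EuclideanSpace ℝ (Fin d) → ℝ} (hπ : Measurable π) (hπ_pos : ∀ x, 0 < π x)
    (x : EuclideanSpace ℝ (Fin d)) {A : Set (EuclideanSpace ℝ (Fin d))} (hA : MeasurableSet A) :
    spsKernel d R h π x A = (∫⁻ y in A, ENNReal.ofReal (moveDensity R h π x y)) +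
      (1 - ∫⁻ y, ENNReal.ofReal (moveDensity R h π x y)) * Measure.dirac x A := by
  have hq : Measurable (proposalDensity R h x) := (measurable_proposalDensity R h).of_uncurry_left
  have ha : Measurable (accept R π x) := (measurable_accept R hπ).of_uncurry_left
  have key : ∀ B : Set (EuclideanSpace ℝ (Fin d)), MeasurableSet B →
      ∫⁻ y in B, accept R π x y ∂((isotropicGaussian (d + 1) h).map (propose R x)) =
        ∫⁻ y in B, ENNReal.ofReal (moveDensity R h π x y) := by
    intro B hB
    rw [map_propose_eq_withDensity hd hR hh,
      setLIntegral_withDensity_eq_setLIntegral_mul _ (by fun_prop) ha hB]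
    refine lintegral_congr fun y => ?_
    have h0 : 0 ≤ min 1 (sphereDensity R π y / sphereDensity R π x) :=
      le_min zero_le_one
        (div_nonneg (sphereDensity_pos hR hπ_pos y).le (sphereDensity_pos hR hπ_pos x).le)
    rw [moveDensity, ENNReal.ofReal_mul h0, mul_comm]
    rfl
  rw [spsKernel_apply R h hπ x hA, key A hA, ← setLIntegral_univ (μ := Measure.map _ _),
    key _ MeasurableSet.univ, setLIntegral_univ]

/-- Detailed balance: both sides equal the minimum of the two sphere densities times a factor
symmetric in `x` and `y`. -/
theorem mul_moveDensity_comm {d : ℕ} {R : ℝ} (hR : 0 < R) (h : ℝ)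
    {π : EuclideanSpace ℝ (Fin d) → ℝ} (hπ_pos : ∀ x, 0 < π x) (x y : EuclideanSpace ℝ (Fin d)) :
    π x * moveDensity R h π x y = π y * moveDensity R h π y x := by
  have key : ∀ x y : EuclideanSpace ℝ (Fin d), π x * moveDensity R h π x y =
      min (sphereDensity R π x) (sphereDensity R π y) * ((2 * R) ^ d /
        ((R ^ 2 + ‖x‖ ^ 2) ^ d * (R ^ 2 + ‖y‖ ^ 2) ^ d) *
        proposalProfile d h (inner ℝ (stereoInv R x) (stereoInv R y))) := by
    intro x y
    have hp := sphereDensity_pos hR hπ_pos x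
    have hx := hπ_pos x
    have hmin : min (sphereDensity R π x) (sphereDensity R π y) =
        π x * (R ^ 2 + ‖x‖ ^ 2) ^ d *
          min 1 (sphereDensity R π y / sphereDensity R π x) := by
      change _ = sphereDensity R π x * _
      rw [mul_min_of_nonneg _ _ hp.le, mul_one, mul_div_cancel₀ _ hp.ne']
    have hnx : (R ^ 2 + ‖x‖ ^ 2) ^ d ≠ 0 := by positivity
    have hny : (R ^ 2 + ‖y‖ ^ 2) ^ d ≠ 0 := by positivity
    rw [hmin, moveDensity, proposalDensity]
    field_simp
  rw [key x y, key y x, min_comm, mul_comm ((R ^ 2 + ‖x‖ ^ 2) ^ d), real_inner_comm]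

theorem lintegral_target {d : ℕ} {π : EuclideanSpace ℝ (Fin d) → ℝ} (hπ : Measurable π)
    {F : EuclideanSpace ℝ (Fin d) → ℝ≥0∞} (hF : Measurable F)
    {A : Set (EuclideanSpace ℝ (Fin d))} (hA : MeasurableSet A) :
    ∫⁻ x in A, F x ∂(target π) = (∫⁻ x, ENNReal.ofReal (π x))⁻¹ *
      ∫⁻ x in A, ENNReal.ofReal (π x) * F x := by
  rw [target, Measure.restrict_smul, lintegral_smul_measure, smul_eq_mul,
    setLIntegral_withDensity_eq_setLIntegral_mul _ (by fun_prop) hF hA]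
  rfl

/-- The rejection part charges only the diagonal and contributes an integral over `A ∩ B`; the
accepted part is symmetric by detailed balance and Tonelli. -/
theorem isReversible_spsKernel {d : ℕ} (hd : 0 < d) {R : ℝ} (hR : 0 < R) {h : ℝ}
    (hh : 0 < h) {π : EuclideanSpace ℝ (Fin d) → ℝ} (hπ : Measurable π) (hπ_pos : ∀ x, 0 < π x) :
    (spsKernel d R h π).IsReversible (target π) := by
  intro A B hA hB
  have hm := measurable_moveDensity R h hπ
  set a : EuclideanSpace ℝ (Fin d) → ℝ≥0∞ := fun x =>
    1 - ∫⁻ y, ENNReal.ofReal (moveDensity R h π x y) with ha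
  have key : ∀ A B : Set (EuclideanSpace ℝ (Fin d)), MeasurableSet A → MeasurableSet B →
      ∫⁻ x in A, ENNReal.ofReal (π x) * spsKernel d R h π x B =
        (∫⁻ x in A, ∫⁻ y in B, ENNReal.ofReal (π x * moveDensity R h π x y)) +
          ∫⁻ x in B ∩ A, ENNReal.ofReal (π x) * a x := by
    intro A B hA hB
    have h1 : ∀ x, ENNReal.ofReal (π x) * spsKernel d R h π x B =
        (∫⁻ y in B, ENNReal.ofReal (π x * moveDensity R h π x y)) +
          B.indicator (fun x => ENNReal.ofReal (π x) * a x) x := by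
      intro x
      rw [spsKernel_apply_eq_moveDensity hd hR hh hπ hπ_pos x hB, mul_add]
      congr 1
      · rw [← lintegral_const_mul' _ _ ENNReal.ofReal_ne_top]
        refine lintegral_congr fun y => ?_
        rw [ENNReal.ofReal_mul (hπ_pos x).le]
      · rw [Measure.dirac_apply' _ hB]
        by_cases hx : x ∈ B <;> simp [hx, ha]
    simp only [h1]
    rw [lintegral_add_left, lintegral_indicator hB, Measure.restrict_restrict hB]
    have : Measurable fun p : EuclideanSpace ℝ (Fin d) × EuclideanSpace ℝ (Fin d) =>
      ENNReal.ofReal (π p.1 * moveDensity R h π p.1 p.2) := by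
      unfold Function.uncurry at hm
      fun_prop
    exact this.lintegral_prod_right'
  have hP : ∀ B, MeasurableSet B → Measurable fun x => spsKernel d R h π x B :=
    fun B hB => Kernel.measurable_coe _ hB
  rw [lintegral_target hπ (hP B hB) hA, lintegral_target hπ (hP A hA) hB, key A B hA hB,
    key B A hB hA, Set.inter_comm]
  congr 2
  rw [lintegral_lintegral_swap]
  · simp only [mul_moveDensity_comm hR h hπ_pos]
  · refine Measurable.aemeasurable ?_
    unfold Function.uncurry at hm ⊢
    fun_prop

theorem isProbabilityMeasure_target {d : ℕ} {π : EuclideanSpace ℝ (Fin d) → ℝ}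
    (hπ_pos : ∀ x, 0 < π x) (hπ_int : Integrable π volume) :
    IsProbabilityMeasure (target π) := by
  refine ⟨?_⟩
  rw [target, Measure.smul_apply, withDensity_apply _ MeasurableSet.univ, setLIntegral_univ,
    smul_eq_mul, ENNReal.inv_mul_cancel]
  · rw [← ofReal_integral_eq_lintegral_ofReal hπ_int (ae_of_all _ fun x => (hπ_pos x).le)]
    refine (ENNReal.ofReal_pos.2 ?_).ne'
    rw [integral_pos_iff_support_of_nonneg (fun x => (hπ_pos x).le) hπ_int,
      Set.eq_univ_of_forall fun x => Function.mem_support.2 (hπ_pos x).ne']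
    exact isOpen_univ.measure_pos volume Set.univ_nonempty
  · exact hπ_int.lintegral_lt_top.ne

theorem target_singleton {d : ℕ} (hd : 0 < d) (π : EuclideanSpace ℝ (Fin d) → ℝ)
    (x : EuclideanSpace ℝ (Fin d)) : target π {x} = 0 := by
  have : Nonempty (Fin d) := ⟨⟨0, hd⟩⟩
  rw [target, Measure.smul_apply, withDensity_apply _ (measurableSet_singleton x),
    Measure.restrict_singleton]
  simp

/-! ### Necessity: sticky points when the sphere density is unbounded -/

theorem pow_mul_exp_neg_le {a : ℝ} (ha : 0 < a) (m : ℕ) {s : ℝ} (hs : 1 ≤ s) :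
    s ^ m * Real.exp (-(a * s ^ 2)) ≤ m.factorial / a ^ m := by
  have h1 : (a * s ^ 2) ^ m / m.factorial ≤ Real.exp (a * s ^ 2) :=
    Real.pow_div_factorial_le_exp _ (by positivity) m
  have h2 : s ^ m ≤ (s ^ 2) ^ m := by gcongr; nlinarith
  have hf : (0 : ℝ) < m.factorial := by positivity
  rw [Real.exp_neg, ← div_eq_mul_inv, div_le_div_iff₀ (Real.exp_pos _) (by positivity)]
  calc s ^ m * a ^ m ≤ (s ^ 2) ^ m * a ^ m := by gcongr
    _ = m.factorial * ((a * s ^ 2) ^ m / m.factorial) := by rw [mul_pow]; field_simp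
    _ ≤ m.factorial * Real.exp (a * s ^ 2) := by gcongr

/-- As the angle approaches a right angle, the blow-up `c^(-(d+1))` is beaten by the Gaussian factor
`exp (-1 / (2 h² c²))`. -/
theorem exists_proposalProfile_le (d : ℕ) {h : ℝ} (hh : 0 < h) :
    ∃ K, 0 < K ∧ ∀ c ≤ 1, proposalProfile d h c ≤ K := by
  set a := 1 / (2 * h ^ 2) with ha_def
  have ha : 0 < a := by positivity
  set D := (√(2 * Real.pi))⁻¹ ^ d * Real.exp a / h ^ d
  have hD : 0 < D := by positivity
  refine ⟨D * ((d + 1).factorial / a ^ (d + 1)), by positivity, fun c hc1 => ?_⟩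
  unfold proposalProfile
  split_ifs with hc
  · have hs : 1 ≤ 1 / c := by rwa [le_div_iff₀ hc, one_mul]
    calc gaussianRadial d ((1 / c ^ 2 - 1) / h ^ 2) / (h ^ d * c ^ (d + 1))
        = D * ((1 / c) ^ (d + 1) * Real.exp (-(a * (1 / c) ^ 2))) := by
          have : -((1 / c ^ 2 - 1) / h ^ 2) / 2 = a + -(a * (1 / c) ^ 2) := by
            rw [ha_def]
            field_simp
            ring
          rw [gaussianRadial, this, Real.exp_add]
          simp only [D, div_pow, one_pow]
          field_simp
      _ ≤ _ := by
          gcongr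
          exact pow_mul_exp_neg_le ha (d + 1) hs
  · positivity

theorem lintegral_inv_norm_pow_lt_top {d : ℕ} (hd : 0 < d) {R : ℝ} (hR : 0 < R) :
    ∫⁻ y : EuclideanSpace ℝ (Fin d), ENNReal.ofReal (1 / (R ^ 2 + ‖y‖ ^ 2) ^ d) < ∞ := by
  -- The decay exponent `2d` exceeds the dimension because `d > 0`.
  have hint : Integrable fun y : EuclideanSpace ℝ (Fin d) =>
      ((1 : ℝ) + ‖y‖ ^ 2) ^ (-(2 * d : ℝ) / 2) := by
    refine integrable_rpow_neg_one_add_norm_sq ?_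
    rw [finrank_euclideanSpace_fin]
    have : (0 : ℝ) < d := by exact_mod_cast hd
    linarith
  set m := min 1 (R ^ 2)
  have hm : 0 < m := lt_min one_pos (by positivity)
  refine lt_of_le_of_lt (lintegral_mono fun y => ENNReal.ofReal_le_ofReal ?_)
    (hint.const_mul ((1 / m) ^ d)).lintegral_lt_top
  have h1 : m * (1 + ‖y‖ ^ 2) ≤ R ^ 2 + ‖y‖ ^ 2 := by
    have h2 : m ≤ 1 := min_le_left _ _
    have h3 : m ≤ R ^ 2 := min_le_right _ _
    nlinarith [sq_nonneg ‖y‖]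
  have h2 : ((1 : ℝ) + ‖y‖ ^ 2) ^ (-(2 * d : ℝ) / 2) = 1 / (1 + ‖y‖ ^ 2) ^ d := by
    rw [show -(2 * d : ℝ) / 2 = -(d : ℝ) by ring, Real.rpow_neg (by positivity),
      Real.rpow_natCast, one_div]
  rw [h2, div_pow, one_pow, div_mul_div_comm, one_mul, ← mul_pow]
  gcongr

theorem moveDensity_le {d : ℕ} {R : ℝ} (hR : 0 < R) {h K : ℝ} (hh : 0 < h)
    (hK : ∀ c ≤ 1, proposalProfile d h c ≤ K) {π : EuclideanSpace ℝ (Fin d) → ℝ}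
    (hπ_pos : ∀ x, 0 < π x) {k : ℝ} (hk : 0 < k) {x : EuclideanSpace ℝ (Fin d)}
    (hx : k ≤ sphereDensity R π x) (y : EuclideanSpace ℝ (Fin d)) :
    moveDensity R h π x y ≤
      min 1 (sphereDensity R π y / k) * ((2 * R) ^ d * K * (1 / (R ^ 2 + ‖y‖ ^ 2) ^ d)) := by
  have hy := sphereDensity_pos hR hπ_pos y
  have hc := hK _ (inner_stereoInv_le_one hR x y)
  have hc0 := proposalProfile_nonneg d hh (inner ℝ (stereoInv R x) (stereoInv R y))
  have h0 : 0 ≤ min 1 (sphereDensity R π y / k) := le_min zero_le_one (by positivity)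
  unfold moveDensity proposalDensity
  refine mul_le_mul ?_ ?_ (by positivity) h0
  · gcongr
  · calc _ ≤ (2 * R) ^ d / (R ^ 2 + ‖y‖ ^ 2) ^ d * K := by gcongr
      _ = _ := by ring

theorem tendsto_lintegral_moveDensity {d : ℕ} (hd : 0 < d) {R : ℝ} (hR : 0 < R) {h : ℝ}
    (hh : 0 < h) {π : EuclideanSpace ℝ (Fin d) → ℝ} (hπ : Measurable π) (hπ_pos : ∀ x, 0 < π x)
    {u : ℕ → EuclideanSpace ℝ (Fin d)} (hu : ∀ k : ℕ, (k : ℝ) + 1 ≤ sphereDensity R π (u k)) :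
    Filter.Tendsto (fun k => ∫⁻ y, ENNReal.ofReal (moveDensity R h π (u k) y)) Filter.atTop
      (nhds 0) := by
  obtain ⟨K, hK0, hK⟩ := exists_proposalProfile_le d hh
  set B : EuclideanSpace ℝ (Fin d) → ℝ := fun y =>
    (2 * R) ^ d * K * (1 / (R ^ 2 + ‖y‖ ^ 2) ^ d) with hB
  have hB0 : ∀ y, 0 ≤ B y := fun y => by positivity
  have hBm : Measurable B := by fun_prop
  have hpm : Measurable (sphereDensity R π) := by unfold sphereDensity; fun_prop
  set f : ℕ → EuclideanSpace ℝ (Fin d) → ℝ≥0∞ := fun k y =>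
    ENNReal.ofReal (min 1 (sphereDensity R π y / (k + 1)) * B y)
  have hf : Filter.Tendsto (fun k => ∫⁻ y, f k y) Filter.atTop
      (nhds (∫⁻ _ : EuclideanSpace ℝ (Fin d), 0)) := by
    refine tendsto_lintegral_of_dominated_convergence (fun y => ENNReal.ofReal (B y))
      (fun k => by fun_prop) (fun k => ae_of_all _ fun y => ?_) ?_ (ae_of_all _ fun y => ?_)
    · exact ENNReal.ofReal_le_ofReal (mul_le_of_le_one_left (hB0 y) (min_le_left _ _))
    · simp only [hB]
      rw [lintegral_congr fun y => ENNReal.ofReal_mul (p := (2 * R) ^ d * K) (by positivity),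
        lintegral_const_mul' _ _ ENNReal.ofReal_ne_top]
      exact ENNReal.mul_ne_top ENNReal.ofReal_ne_top (lintegral_inv_norm_pow_lt_top hd hR).ne
    · have h1 : Filter.Tendsto (fun k : ℕ => sphereDensity R π y * (1 / ((k : ℝ) + 1)))
          Filter.atTop (nhds (sphereDensity R π y * 0)) :=
        tendsto_one_div_add_atTop_nhds_zero_nat.const_mul _
      have h2 : Filter.Tendsto (fun k : ℕ => ENNReal.ofReal
          (min 1 (sphereDensity R π y * (1 / ((k : ℝ) + 1))) * B y)) Filter.atTop
          (nhds (ENNReal.ofReal (min 1 (sphereDensity R π y * 0) * B y))) :=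
        ENNReal.tendsto_ofReal ((tendsto_const_nhds.min h1).mul_const _)
      simpa [f, div_eq_mul_inv] using h2
  rw [lintegral_zero] at hf
  refine tendsto_of_tendsto_of_tendsto_of_le_of_le tendsto_const_nhds hf
    (fun k => zero_le) fun k => lintegral_mono fun y => ENNReal.ofReal_le_ofReal ?_
  exact moveDensity_le hR hh hK hπ_pos (by positivity) (hu k) y

theorem isMarkovKernel_pow {E : Type*} [MeasurableSpace E] (P : Kernel E E) [IsMarkovKernel P]
    (n : ℕ) : IsMarkovKernel (P ^ n) := by
  induction n with
  | zero => exact inferInstanceAs (IsMarkovKernel (Kernel.id : Kernel E E))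
  | succ n ih => exact inferInstanceAs (IsMarkovKernel ((P ^ n) ∘ₖ P))

/-- One way to be at `x` after `n` steps is never to have left it. -/
theorem pow_apply_singleton_le {E : Type*} [MeasurableSpace E] [MeasurableSingletonClass E]
    (P : Kernel E E) (x : E) (n : ℕ) : (P x {x}) ^ n ≤ (P ^ n) x {x} := by
  induction n with
  | zero =>
    rw [pow_zero, pow_zero, show (1 : Kernel E E) = Kernel.id from rfl, Kernel.id_apply]
    simp
  | succ n ih =>
    rw [Kernel.pow_succ_apply_eq_lintegral _ _ _ (measurableSet_singleton x), pow_succ']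
    calc P x {x} * P x {x} ^ n ≤ P x {x} * (P ^ n) x {x} := by gcongr
      _ = ∫⁻ b in {x}, P b {x} ∂(P ^ n) x := by rw [lintegral_singleton]
      _ ≤ _ := setLIntegral_le_lintegral _ _

theorem bddAbove_of_uniformlyErgodic {d : ℕ} (hd : 0 < d) {R : ℝ} (hR : 0 < R) {h : ℝ}
    (hh : 0 < h) {π : EuclideanSpace ℝ (Fin d) → ℝ} (hπ : Measurable π) (hπ_pos : ∀ x, 0 < π x)
    (hue : UniformlyErgodic (spsKernel d R h π) (target π)) :
    BddAbove (Set.range (sphereDensity R π)) := by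
  by_contra hb
  obtain ⟨M, ρ, hρ0, hρ1, hM⟩ := hue
  have hex : ∀ k : ℕ, ∃ x, (k : ℝ) + 1 ≤ sphereDensity R π x := fun k => by
    rw [not_bddAbove_iff] at hb
    obtain ⟨_, ⟨x, rfl⟩, hx⟩ := hb (k + 1)
    exact ⟨x, hx.le⟩
  choose u hu using hex
  have hlim := tendsto_lintegral_moveDensity hd hR hh hπ hπ_pos hu
  have hone : ∀ n : ℕ, 1 ≤ ENNReal.ofReal (M * ρ ^ n) := by
    intro n
    -- With `n` fixed, let the starting point vary: the probability of `n` successive rejections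
    -- tends to `1`. Only afterwards does `n` tend to infinity.
    have h1 : Filter.Tendsto (fun k => (1 - ∫⁻ y, ENNReal.ofReal (moveDensity R h π (u k) y)) ^ n)
        Filter.atTop (nhds ((1 - 0) ^ n)) :=
      ((ENNReal.continuous_pow n).tendsto _).comp
        (ENNReal.Tendsto.sub tendsto_const_nhds hlim (Or.inl ENNReal.one_ne_top))
    rw [tsub_zero, one_pow] at h1
    refine le_of_tendsto' h1 fun k => ?_
    have hMk : IsMarkovKernel (spsKernel d R h π) := isMarkovKernel_spsKernel R h hπ
    calc (1 - ∫⁻ y, ENNReal.ofReal (moveDensity R h π (u k) y)) ^ n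
        ≤ (spsKernel d R h π (u k) {u k}) ^ n := by
          gcongr
          rw [spsKernel_apply_eq_moveDensity hd hR hh hπ hπ_pos _ (measurableSet_singleton _)]
          simp
      _ ≤ ((spsKernel d R h π) ^ n) (u k) {u k} := pow_apply_singleton_le _ _ _
      _ ≤ tvDist (((spsKernel d R h π) ^ n) (u k)) (target π) := by
          have hPn := isMarkovKernel_pow (spsKernel d R h π) n
          refine le_trans ?_ (le_iSup₂ (f := fun (A : Set (EuclideanSpace ℝ (Fin d)))
            (_ : MeasurableSet A) => ENNReal.ofReal
              |(((spsKernel d R h π) ^ n) (u k)).real A - (target π).real A|)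
            {u k} (measurableSet_singleton _))
          simp only [measureReal_def, target_singleton hd, ENNReal.toReal_zero, sub_zero,
            abs_of_nonneg ENNReal.toReal_nonneg]
          rw [ENNReal.ofReal_toReal (measure_ne_top _ _)]
      _ ≤ _ := hM n (u k)
  have h2 : Filter.Tendsto (fun n : ℕ => ENNReal.ofReal (M * ρ ^ n)) Filter.atTop
      (nhds (ENNReal.ofReal (M * 0))) :=
    ENNReal.tendsto_ofReal ((tendsto_pow_atTop_nhds_zero_of_lt_one hρ0 hρ1).const_mul M)
  have h3 := ge_of_tendsto' h2 hone
  simp at h3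

/-! ### Doeblin's theorem -/

section Doeblin

variable {E : Type*} [MeasurableSpace E]

theorem integrable_of_mem_Icc {μ : Measure E} [IsFiniteMeasure μ] {f : E → ℝ} (hf : Measurable f)
    {m D : ℝ} (hfm : ∀ x, m ≤ f x ∧ f x ≤ m + D) : Integrable f μ := by
  refine Integrable.of_bound hf.aestronglyMeasurable (|m| + |m + D|) (ae_of_all _ fun x => ?_)
  have h1 := neg_abs_le m
  have h2 := le_abs_self (m + D)
  have h3 := abs_nonneg m
  have h4 := abs_nonneg (m + D)
  rw [Real.norm_eq_abs, abs_le]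
  constructor <;> linarith [(hfm x).1, (hfm x).2]

/-- Compare the integrals of the nonnegative functions `f - m` and `m + D - f` under `ε ν` and `μ`.
The resulting interval depends on `ν` but not on `μ`, and its length has shrunk by the factor `1 -
ε`. -/
theorem integral_mem_Icc_of_minorization {μ ν : Measure E} [IsProbabilityMeasure μ]
    [IsProbabilityMeasure ν] {ε : ℝ} (hε : 0 ≤ ε) (hμν : ENNReal.ofReal ε • ν ≤ μ) {f : E → ℝ}
    (hf : Measurable f) {m D : ℝ} (hfm : ∀ x, m ≤ f x ∧ f x ≤ m + D) :
    ε * ∫ x, f x ∂ν + (1 - ε) * m ≤ ∫ x, f x ∂μ ∧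
      ∫ x, f x ∂μ ≤ ε * ∫ x, f x ∂ν + (1 - ε) * m + (1 - ε) * D := by
  have hiμ : Integrable f μ := integrable_of_mem_Icc hf hfm
  have hiν : Integrable f ν := integrable_of_mem_Icc hf hfm
  have h1 : ∫ x, (f x - m) ∂(ENNReal.ofReal ε • ν) ≤ ∫ x, (f x - m) ∂μ :=
    integral_mono_measure hμν (ae_of_all _ fun x => sub_nonneg.2 (hfm x).1)
      (hiμ.sub (integrable_const m))
  have h2 : ∫ x, (m + D - f x) ∂(ENNReal.ofReal ε • ν) ≤ ∫ x, (m + D - f x) ∂μ :=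
    integral_mono_measure hμν (ae_of_all _ fun x => sub_nonneg.2 (hfm x).2)
      ((integrable_const _).sub hiμ)
  rw [integral_smul_measure, integral_sub hiν (integrable_const m),
    integral_sub hiμ (integrable_const m), ENNReal.toReal_ofReal hε] at h1
  rw [integral_smul_measure, integral_sub (integrable_const _) hiν,
    integral_sub (integrable_const _) hiμ, ENNReal.toReal_ofReal hε] at h2
  simp only [integral_const, probReal_univ, smul_eq_mul] at h1 h2
  constructor <;> linarith

theorem real_pow_add_apply (P : Kernel E E) [IsMarkovKernel P] (m n : ℕ) (x : E) {A : Set E}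
    (hA : MeasurableSet A) :
    ((P ^ (m + n)) x).real A = ∫ y, ((P ^ n) y).real A ∂((P ^ m) x) := by
  have := isMarkovKernel_pow P n
  simp only [measureReal_def]
  rw [Kernel.pow_add_apply_eq_lintegral P m n x hA, integral_toReal]
  · exact (Kernel.measurable_coe _ hA).aemeasurable
  · exact ae_of_all _ fun y => measure_lt_top _ _

theorem measurable_real_apply (P : Kernel E E) {A : Set E} (hA : MeasurableSet A) :
    Measurable fun x => (P x).real A :=
  (Kernel.measurable_coe _ hA).ennreal_toReal

theorem invariant_pow {P : Kernel E E} {μ : Measure E} (hP : P.Invariant μ) (n : ℕ) :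
    (P ^ n).Invariant μ := by
  induction n with
  | zero => exact Measure.bind_dirac
  | succ n ih => exact ih.comp hP

/-- **Doeblin's theorem**: a Markov kernel one of whose powers satisfies a uniform minorization
converges geometrically to its invariant distribution, uniformly in the starting point. -/
theorem uniformlyErgodic_of_minorization {P : Kernel E E} [IsMarkovKernel P] {μ : Measure E}
    [IsProbabilityMeasure μ] (hP : P.Invariant μ) {ν : Measure E} [IsProbabilityMeasure ν]
    {ε : ℝ} (hε0 : 0 < ε) (hε1 : ε < 1) {m : ℕ} (hm : 0 < m)
    (hmin : ∀ x, ENNReal.ofReal ε • ν ≤ (P ^ m) x) : UniformlyErgodic P μ := by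
  have hpow := isMarkovKernel_pow P
  have h1ε : 0 < 1 - ε := by linarith
  -- The oscillation in `x` of the probability of `A` contracts by `1 - ε` every `m` steps; the
  -- remainder `r` allows step counts not divisible by `m`.
  have hosc : ∀ {A : Set E}, MeasurableSet A → ∀ r j : ℕ, ∃ c : ℝ, ∀ x,
      c ≤ ((P ^ (m * j + r)) x).real A ∧ ((P ^ (m * j + r)) x).real A ≤ c + (1 - ε) ^ j := by
    intro A hA r j
    induction j with
    | zero => exact ⟨0, fun x => by simp⟩
    | succ j ih =>
      obtain ⟨c, hc⟩ := ih
      refine ⟨ε * ∫ y, ((P ^ (m * j + r)) y).real A ∂ν + (1 - ε) * c, fun x => ?_⟩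
      rw [show m * (j + 1) + r = m + (m * j + r) by ring, real_pow_add_apply P _ _ x hA,
        pow_succ']
      exact integral_mem_Icc_of_minorization hε0.le (hmin x) (measurable_real_apply _ hA) hc
  -- The rate per single step; the constant `(1 - ε)⁻¹` pays for rounding `n / m` down.
  set ρ := (1 - ε) ^ ((1 : ℝ) / m)
  have hm' : (0 : ℝ) < m := by exact_mod_cast hm
  refine ⟨(1 - ε)⁻¹, ρ, by positivity, Real.rpow_lt_one h1ε.le (by linarith) (by positivity),
    fun n x => iSup₂_le fun A hA => ENNReal.ofReal_le_ofReal ?_⟩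
  obtain ⟨c, hc⟩ := hosc hA (n % m) (n / m)
  rw [Nat.div_add_mod] at hc
  -- By invariance `μ A` is an average of the `n`-step probabilities, so it lies in the same short
  -- interval.
  have hμ : μ.real A = ∫ y, ((P ^ n) y).real A ∂μ := by
    have h1 : μ A = ∫⁻ y, (P ^ n) y A ∂μ := by
      conv_lhs => rw [← (invariant_pow hP n).def]
      rw [Measure.bind_apply hA (Kernel.aemeasurable _)]
    simp only [measureReal_def]
    rw [h1, integral_toReal (Kernel.measurable_coe _ hA).aemeasurable
      (ae_of_all _ fun y => measure_lt_top _ _)]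
  have hi : Integrable (fun y => ((P ^ n) y).real A) μ :=
    integrable_of_mem_Icc (measurable_real_apply _ hA) hc
  have hl : c ≤ μ.real A := by
    rw [hμ]
    simpa using integral_mono (integrable_const c) hi fun y => (hc y).1
  have hu : μ.real A ≤ c + (1 - ε) ^ (n / m) := by
    rw [hμ]
    simpa using integral_mono hi (integrable_const (c + (1 - ε) ^ (n / m))) fun y => (hc y).2
  calc |((P ^ n) x).real A - μ.real A| ≤ (1 - ε) ^ (n / m) := by
        rw [abs_le]
        constructor <;> linarith [(hc x).1, (hc x).2]
    _ = (1 - ε)⁻¹ * (1 - ε) ^ (((n / m : ℕ) : ℝ) + 1) := by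
        rw [Real.rpow_add h1ε, Real.rpow_natCast, Real.rpow_one]
        field_simp
    _ ≤ (1 - ε)⁻¹ * (1 - ε) ^ (1 / (m : ℝ) * n) := by
        have hle : 1 / (m : ℝ) * n ≤ ((n / m : ℕ) : ℝ) + 1 := by
          have h1 : (n : ℝ) ≤ m * ((n / m : ℕ) + 1) := by
            exact_mod_cast (Nat.lt_mul_div_succ n hm).le
          rw [one_div_mul_eq_div, div_le_iff₀ hm']
          linarith
        exact mul_le_mul_of_nonneg_left
          (Real.rpow_le_rpow_of_exponent_ge h1ε (by linarith) hle) (by positivity)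
    _ = (1 - ε)⁻¹ * ρ ^ n := by rw [Real.rpow_mul h1ε.le, Real.rpow_natCast]

theorem mul_le_pow_succ_apply (P : Kernel E E) {n : ℕ} {A U : Set E} (hA : MeasurableSet A)
    (hU : MeasurableSet U) {b : ℝ≥0∞} (hb : ∀ y ∈ U, b ≤ (P ^ n) y A) (x : E) :
    b * P x U ≤ (P ^ (1 + n)) x A := by
  rw [Kernel.pow_add_apply_eq_lintegral P 1 n x hA, pow_one, ← setLIntegral_const]
  exact (setLIntegral_mono' hU hb).trans (setLIntegral_le_lintegral _ _)

end Doeblin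

/-! ### Sufficiency: minorization of the three-step kernel -/

theorem le_proposalProfile {d : ℕ} {h δ c : ℝ} (hh : 0 < h) (hδ : 0 < δ) (hc : δ ≤ c)
    (hc1 : c ≤ 1) : gaussianRadial d ((1 / δ ^ 2 - 1) / h ^ 2) / h ^ d ≤ proposalProfile d h c := by
  have hc0 : 0 < c := hδ.trans_le hc
  have hg := gaussianRadial_pos d ((1 / c ^ 2 - 1) / h ^ 2)
  rw [proposalProfile, if_pos hc0]
  have h1 : gaussianRadial d ((1 / δ ^ 2 - 1) / h ^ 2) ≤
      gaussianRadial d ((1 / c ^ 2 - 1) / h ^ 2) := by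
    unfold gaussianRadial
    gcongr
  have h2 : h ^ d * c ^ (d + 1) ≤ h ^ d :=
    mul_le_of_le_one_right (by positivity) (pow_le_one₀ hc0.le hc1)
  gcongr

/-- The unnormalised target measure. -/
noncomputable def unnormalizedTarget {d : ℕ} (π : EuclideanSpace ℝ (Fin d) → ℝ) :
    Measure (EuclideanSpace ℝ (Fin d)) :=
  volume.withDensity fun x => ENNReal.ofReal (π x)

theorem exists_mul_le_spsKernel {d : ℕ} (hd : 0 < d) {R : ℝ} (hR : 0 < R) {h : ℝ}
    (hh : 0 < h) {π : EuclideanSpace ℝ (Fin d) → ℝ} (hπ : Measurable π) (hπ_pos : ∀ x, 0 < π x)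
    (hb : BddAbove (Set.range (sphereDensity R π))) {δ : ℝ} (hδ : 0 < δ) :
    ∃ c, 0 < c ∧ ∀ (x : EuclideanSpace ℝ (Fin d)) (A : Set (EuclideanSpace ℝ (Fin d))),
      MeasurableSet A → (∀ y ∈ A, δ ≤ inner ℝ (stereoInv R x) (stereoInv R y)) →
        ENNReal.ofReal c * unnormalizedTarget π A ≤ spsKernel d R h π x A := by
  obtain ⟨C, hC⟩ := hb
  have hC : ∀ x, sphereDensity R π x ≤ C := fun x => hC ⟨x, rfl⟩
  have hC0 : 0 < C := (sphereDensity_pos hR hπ_pos 0).trans_le (hC 0)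
  set κ := gaussianRadial d ((1 / δ ^ 2 - 1) / h ^ 2) / h ^ d
  have hκ : 0 < κ := div_pos (gaussianRadial_pos _ _) (by positivity)
  refine ⟨(2 * R) ^ d * κ / C, by positivity, fun x A hA hxA => ?_⟩
  rw [spsKernel_apply_eq_moveDensity hd hR hh hπ hπ_pos x hA, unnormalizedTarget,
    withDensity_apply _ hA, ← lintegral_const_mul' _ _ ENNReal.ofReal_ne_top]
  refine le_trans (setLIntegral_mono' hA fun y hy => ?_) le_self_add
  rw [← ENNReal.ofReal_mul (by positivity)]
  refine ENNReal.ofReal_le_ofReal ?_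
  have hy0 := sphereDensity_pos hR hπ_pos y
  have hx0 := sphereDensity_pos hR hπ_pos x
  have h1 : sphereDensity R π y / C ≤ min 1 (sphereDensity R π y / sphereDensity R π x) := by
    refine le_min ((div_le_one hC0).2 (hC y)) ?_
    gcongr
    exact hC x
  have h2 := le_proposalProfile (d := d) hh hδ (hxA y hy) (inner_stereoInv_le_one hR x y)
  have hn : (R ^ 2 + ‖y‖ ^ 2) ^ d ≠ 0 := by positivity
  calc (2 * R) ^ d * κ / C * π y
      = sphereDensity R π y / C * ((2 * R) ^ d / (R ^ 2 + ‖y‖ ^ 2) ^ d * κ) := by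
        unfold sphereDensity
        field_simp
    _ ≤ moveDensity R h π x y := by
        unfold moveDensity proposalDensity
        gcongr

/-- All these balls lie in one compact ball, on which `π` has a positive minimum, and they have
equal volume. -/
theorem exists_le_unnormalizedTarget_ball {d : ℕ} {π : EuclideanSpace ℝ (Fin d) → ℝ}
    (hπ_pos : ∀ x, 0 < π x) (hπ_cont : Continuous π) (s : ℝ) {r : ℝ} (hr : 0 < r) :
    ∃ η, 0 < η ∧ ∀ y : EuclideanSpace ℝ (Fin d), ‖y‖ ≤ s →
      η ≤ unnormalizedTarget π (Metric.ball y r) := by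
  rcases lt_or_ge s 0 with hs | hs
  · exact ⟨1, one_pos, fun y hy => absurd (norm_nonneg y) (not_le.2 (hy.trans_lt hs))⟩
  obtain ⟨x₀, -, hx₀⟩ := (isCompact_closedBall (0 : EuclideanSpace ℝ (Fin d)) (s + r)).exists_isMinOn
    ⟨0, by simp; positivity⟩ hπ_cont.continuousOn
  refine ⟨ENNReal.ofReal (π x₀) * volume (Metric.ball (0 : EuclideanSpace ℝ (Fin d)) r),
    ENNReal.mul_pos (ENNReal.ofReal_pos.2 (hπ_pos x₀)).ne' (Metric.measure_ball_pos _ _ hr).ne',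
    fun y hy => ?_⟩
  rw [unnormalizedTarget, withDensity_apply _ Metric.isOpen_ball.measurableSet,
    ← Measure.addHaar_ball_center volume y r, ← setLIntegral_const]
  refine setLIntegral_mono' Metric.isOpen_ball.measurableSet fun z hz => ?_
  refine ENNReal.ofReal_le_ofReal (hx₀ ?_)
  rw [mem_closedBall_zero_iff]
  have h1 := norm_le_norm_add_norm_sub' z y
  rw [mem_ball_iff_norm] at hz
  linarith

/-- Follows from the exact formula for the chordal distance, by bounding both factors of its
denominator below by `R²`. -/
theorem norm_stereoInv_sub_le {d : ℕ} {R : ℝ} (hR : 0 < R) (x y : EuclideanSpace ℝ (Fin d)) :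
    ‖stereoInv R x - stereoInv R y‖ ≤ 2 / R * ‖x - y‖ := by
  have hsq : ‖stereoInv R x - stereoInv R y‖ ^ 2 =
      4 * R ^ 2 * ‖x - y‖ ^ 2 / ((‖x‖ ^ 2 + R ^ 2) * (‖y‖ ^ 2 + R ^ 2)) := by
    have h1 : ‖x‖ ^ 2 + R ^ 2 ≠ 0 := by positivity
    have h2 : ‖y‖ ^ 2 + R ^ 2 ≠ 0 := by positivity
    rw [norm_sub_sq_real, norm_sub_sq_real, norm_stereoInv hR, norm_stereoInv hR,
      inner_stereoInv hR]
    field_simp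
    ring
  refine (pow_le_pow_iff_left₀ (norm_nonneg _) (by positivity) two_ne_zero).1 ?_
  rw [hsq, div_le_iff₀ (by positivity), mul_pow, div_pow]
  have h3 : R ^ 2 * R ^ 2 ≤ (‖x‖ ^ 2 + R ^ 2) * (‖y‖ ^ 2 + R ^ 2) := by
    gcongr <;> nlinarith [sq_nonneg ‖x‖, sq_nonneg ‖y‖]
  calc 4 * R ^ 2 * ‖x - y‖ ^ 2 = 2 ^ 2 / R ^ 2 * ‖x - y‖ ^ 2 * (R ^ 2 * R ^ 2) := by
        field_simp
        ring
    _ ≤ _ := by gcongr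

theorem inner_stereoInv_perturb {d : ℕ} {R : ℝ} (hR : 0 < R)
    {x x' y y' : EuclideanSpace ℝ (Fin d)} {r : ℝ} (hx : ‖x' - x‖ ≤ r) (hy : ‖y' - y‖ ≤ r) :
    inner ℝ (stereoInv R x) (stereoInv R y) - 4 / R * r ≤
      inner ℝ (stereoInv R x') (stereoInv R y') := by
  have h1 : inner ℝ (stereoInv R x - stereoInv R x') (stereoInv R y) ≤ 2 / R * r := by
    refine (real_inner_le_norm _ _).trans ?_
    rw [norm_stereoInv hR, mul_one]
    refine (norm_stereoInv_sub_le hR _ _).trans ?_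
    rw [norm_sub_rev]
    gcongr
  have h2 : inner ℝ (stereoInv R x') (stereoInv R y - stereoInv R y') ≤ 2 / R * r := by
    refine (real_inner_le_norm _ _).trans ?_
    rw [norm_stereoInv hR, one_mul]
    refine (norm_stereoInv_sub_le hR _ _).trans ?_
    rw [norm_sub_rev]
    gcongr
  rw [inner_sub_left] at h1
  rw [inner_sub_right] at h2
  have h3 : 4 / R * r = 2 / R * r + 2 / R * r := by ring
  linarith

/-- Any point is joined to the origin by a chain of three moves with bounded intermediate points,
each of which makes an angle bounded away from a right angle on the sphere. -/
theorem exists_chain {d : ℕ} (hd : 0 < d) {R : ℝ} (hR : 0 < R) (x : EuclideanSpace ℝ (Fin d)) :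
    ∃ y₁ y₂ : EuclideanSpace ℝ (Fin d), ‖y₁‖ ≤ 2 * R ∧ ‖y₂‖ ≤ 2 * R ∧
      1 / 4 ≤ (inner ℝ (stereoInv R x) (stereoInv R y₁) : ℝ) ∧
      1 / 4 ≤ (inner ℝ (stereoInv R y₁) (stereoInv R y₂) : ℝ) ∧
      1 / 4 ≤ (inner ℝ (stereoInv R y₂) (stereoInv R 0) : ℝ) := by
  obtain ⟨e, he, hxe⟩ : ∃ e : EuclideanSpace ℝ (Fin d), ‖e‖ = 1 ∧ x = ‖x‖ • e := by
    rcases eq_or_ne x 0 with rfl | hx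
    · exact ⟨EuclideanSpace.single ⟨0, hd⟩ 1, by simp, by simp⟩
    · exact ⟨‖x‖⁻¹ • x, norm_smul_inv_norm hx, by
        rw [smul_smul, mul_inv_cancel₀ (norm_ne_zero_iff.2 hx), one_smul]⟩
  have key : ∀ a b : ℝ, inner ℝ (stereoInv R (a • e)) (stereoInv R (b • e)) =
      (4 * R ^ 2 * (a * b) + (a ^ 2 - R ^ 2) * (b ^ 2 - R ^ 2)) /
        ((a ^ 2 + R ^ 2) * (b ^ 2 + R ^ 2)) := by
    intro a b
    rw [inner_stereoInv hR, real_inner_smul_left, real_inner_smul_right,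
      real_inner_self_eq_norm_sq, norm_smul, norm_smul, he]
    simp only [Real.norm_eq_abs, mul_one, sq_abs, one_pow]
  have hlast : 1 / 4 ≤ (inner ℝ (stereoInv R ((R / 2) • e)) (stereoInv R 0) : ℝ) := by
    rw [show (0 : EuclideanSpace ℝ (Fin d)) = (0 : ℝ) • e by simp, key, le_div_iff₀ (by positivity)]
    nlinarith [pow_pos hR 4]
  have hnorm : ∀ a : ℝ, 0 ≤ a → ‖a • e‖ = a := fun a ha => by
    rw [norm_smul, he, mul_one, Real.norm_of_nonneg ha]
  have hx0 := norm_nonneg x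
  -- Everything happens on the great circle through `x` and the poles, in the half containing `e`.
  -- There `2R e` and `(R/2) e` become `(4/5, 3/5)` and `(4/5, -3/5)`, with scalar product `7/25 >
  -- 1/4`. If `x` is in the upper hemisphere it is close enough to the first; otherwise it is close
  -- enough to the second, which is then used twice. Two moves would not do uniformly, since `x` may
  -- be almost antipodal to the origin.
  rcases le_total R ‖x‖ with h | h
  · refine ⟨(2 * R) • e, (R / 2) • e, (hnorm _ (by positivity)).le,
      (hnorm _ (by positivity)).trans_le (by linarith), ?_, ?_, hlast⟩
    · rw [hxe, key, le_div_iff₀ (by positivity)]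
      nlinarith [mul_nonneg (sq_nonneg R) (mul_nonneg hR.le hx0),
        mul_nonneg (sq_nonneg R) (mul_nonneg (sub_nonneg.2 h) hx0), pow_pos hR 4]
    · rw [key, le_div_iff₀ (by positivity)]
      nlinarith [pow_pos hR 4]
  · refine ⟨(R / 2) • e, (R / 2) • e, (hnorm _ (by positivity)).trans_le (by linarith),
      (hnorm _ (by positivity)).trans_le (by linarith), ?_, ?_, hlast⟩
    · rw [hxe, key, le_div_iff₀ (by positivity)]
      nlinarith [mul_nonneg (sq_nonneg R) (mul_nonneg hR.le hx0),
        mul_nonneg (sq_nonneg R) (mul_nonneg (sub_nonneg.2 h) hx0), pow_pos hR 4,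
        mul_nonneg (sq_nonneg R) (mul_nonneg (sub_nonneg.2 h) hR.le)]
    · rw [key, le_div_iff₀ (by positivity)]
      nlinarith [pow_pos hR 4]

theorem exists_minorization_spsKernel {d : ℕ} (hd : 0 < d) {R : ℝ} (hR : 0 < R) {h : ℝ}
    (hh : 0 < h) {π : EuclideanSpace ℝ (Fin d) → ℝ} (hπ_pos : ∀ x, 0 < π x)
    (hπ_cont : Continuous π) (hb : BddAbove (Set.range (sphereDensity R π))) :
    ∃ (ε : ℝ≥0∞) (U : Set (EuclideanSpace ℝ (Fin d))), 0 < ε ∧ MeasurableSet U ∧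
      0 < unnormalizedTarget π U ∧ ∀ (x : EuclideanSpace ℝ (Fin d)) (A), MeasurableSet A →
        ε * unnormalizedTarget π (A ∩ U) ≤ ((spsKernel d R h π) ^ 3) x A := by
  -- Moving both endpoints by `r` costs at most `4 r / R = 1/8` in the cosine, leaving `1/8` of the
  -- `1/4` given by the chain.
  set r := R / 32 with hr_def
  have hr : 0 < r := by positivity
  have h4r : 4 / R * r = 1 / 8 := by
    rw [hr_def]
    field_simp
    norm_num
  obtain ⟨c, hc0, hc⟩ := exists_mul_le_spsKernel hd hR hh hπ_cont.measurable hπ_pos hb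
    (δ := 1 / 8) (by norm_num)
  obtain ⟨η, hη0, hη⟩ := exists_le_unnormalizedTarget_ball hπ_pos hπ_cont (2 * R) hr
  have hmeas : ∀ y : EuclideanSpace ℝ (Fin d), MeasurableSet (Metric.ball y r) :=
    fun y => Metric.isOpen_ball.measurableSet
  have hclose : ∀ {a b a' b' : EuclideanSpace ℝ (Fin d)},
      1 / 4 ≤ (inner ℝ (stereoInv R a) (stereoInv R b) : ℝ) → ‖a' - a‖ ≤ r → ‖b' - b‖ ≤ r →
        1 / 8 ≤ (inner ℝ (stereoInv R a') (stereoInv R b') : ℝ) := by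
    intro a b a' b' hab ha hb
    have := inner_stereoInv_perturb hR ha hb
    linarith
  have hstep : ∀ {a b a' : EuclideanSpace ℝ (Fin d)}, ‖b‖ ≤ 2 * R →
      1 / 4 ≤ (inner ℝ (stereoInv R a) (stereoInv R b) : ℝ) → ‖a' - a‖ ≤ r →
        ENNReal.ofReal c * η ≤ spsKernel d R h π a' (Metric.ball b r) := by
    intro a b a' hb hab ha
    refine le_trans ?_ (hc a' _ (hmeas b) fun y hy =>
      hclose hab ha (mem_ball_iff_norm.1 hy).le)
    gcongr
    exact hη b hb
  have hcη : ENNReal.ofReal c * η ≠ 0 := mul_ne_zero (ENNReal.ofReal_pos.2 hc0).ne' hη0.ne'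
  refine ⟨ENNReal.ofReal c * (ENNReal.ofReal c * η) * (ENNReal.ofReal c * η), Metric.ball 0 r,
    pos_iff_ne_zero.2 (mul_ne_zero (mul_ne_zero (ENNReal.ofReal_pos.2 hc0).ne' hcη) hcη),
    hmeas 0, hη0.trans_le (hη 0 (by simp; positivity)), fun x A hA => ?_⟩
  obtain ⟨y₁, y₂, hy₁, hy₂, h1, h2, h3⟩ := exists_chain hd hR x
  have hA0 : MeasurableSet (A ∩ Metric.ball 0 r) := hA.inter (hmeas 0)
  set T := unnormalizedTarget π (A ∩ Metric.ball 0 r)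
  have s1 : ∀ z ∈ Metric.ball y₂ r, ENNReal.ofReal c * T ≤ ((spsKernel d R h π) ^ 1) z A := by
    intro z hz
    rw [pow_one]
    refine (hc z _ hA0 fun y hy => ?_).trans (measure_mono Set.inter_subset_left)
    exact hclose h3 (mem_ball_iff_norm.1 hz).le (mem_ball_iff_norm.1 hy.2).le
  have s2 : ∀ z ∈ Metric.ball y₁ r,
      ENNReal.ofReal c * T * (ENNReal.ofReal c * η) ≤ ((spsKernel d R h π) ^ 2) z A := by
    intro z hz
    refine le_trans ?_ (mul_le_pow_succ_apply _ hA (hmeas y₂) s1 z)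
    gcongr
    exact hstep hy₂ h2 (mem_ball_iff_norm.1 hz).le
  calc _ = ENNReal.ofReal c * T * (ENNReal.ofReal c * η) * (ENNReal.ofReal c * η) := by ring
    _ ≤ ENNReal.ofReal c * T * (ENNReal.ofReal c * η) *
        spsKernel d R h π x (Metric.ball y₁ r) := by
        gcongr
        exact hstep hy₁ h1 (by simpa using hr.le)
    _ ≤ _ := mul_le_pow_succ_apply _ hA (hmeas y₁) s2 x

theorem uniformlyErgodic_of_bddAbove {d : ℕ} (hd : 0 < d) {R : ℝ} (hR : 0 < R) {h : ℝ}
    (hh : 0 < h) {π : EuclideanSpace ℝ (Fin d) → ℝ} (hπ_pos : ∀ x, 0 < π x)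
    (hπ_cont : Continuous π) (hπ_int : Integrable π volume)
    (hb : BddAbove (Set.range (sphereDensity R π))) :
    UniformlyErgodic (spsKernel d R h π) (target π) := by
  have hπ := hπ_cont.measurable
  have hMk : IsMarkovKernel (spsKernel d R h π) := isMarkovKernel_spsKernel R h hπ
  have hpr := isProbabilityMeasure_target hπ_pos hπ_int
  obtain ⟨ε, U, hε, hU, hU0, hmin⟩ := exists_minorization_spsKernel hd hR hh hπ_pos hπ_cont hb
  set μ := unnormalizedTarget π
  have hfin : IsFiniteMeasure μ := isFiniteMeasure_withDensity_ofReal hπ_int.2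
  have hν : IsProbabilityMeasure (cond μ U) := cond_isProbabilityMeasure hU0.ne'
  -- `ε * μ U` is the mass of the minorizing measure; the cap `1 / 2` secures the strict inequality
  -- required by Doeblin's theorem.
  set b := min (ε * μ U) (1 / 2)
  have hb0 : 0 < b := lt_min (ENNReal.mul_pos hε.ne' hU0.ne') (by norm_num)
  have hbt : b ≠ ∞ := ne_top_of_le_ne_top (by norm_num) (min_le_right _ _)
  have hb1 : b.toReal < 1 := by
    have h1 : b.toReal ≤ (1 / 2 : ℝ≥0∞).toReal :=
      ENNReal.toReal_mono (by norm_num) (min_le_right _ _)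
    have h2 : (1 / 2 : ℝ≥0∞).toReal = 1 / 2 := by norm_num
    linarith
  refine uniformlyErgodic_of_minorization (isReversible_spsKernel hd hR hh hπ hπ_pos).invariant
    (ν := cond μ U) (ENNReal.toReal_pos hb0.ne' hbt) hb1 (m := 3) (by norm_num) fun x => ?_
  rw [ENNReal.ofReal_toReal hbt]
  refine Measure.le_iff.2 fun A hA => ?_
  rw [Measure.smul_apply, smul_eq_mul, cond_apply hU]
  calc b * ((μ U)⁻¹ * μ (U ∩ A)) ≤ ε * μ U * ((μ U)⁻¹ * μ (U ∩ A)) := by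
        gcongr
        exact min_le_left _ _
    _ = ε * μ (A ∩ U) := by
        rw [mul_assoc, ← mul_assoc (μ U), ENNReal.mul_inv_cancel hU0.ne' (measure_ne_top _ _),
          one_mul, Set.inter_comm]
    _ ≤ _ := hmin x A hA

end SPS

theorem mainTheorem1 (d : ℕ) (hd : 0 < d) (R : ℝ) (hR : 0 < R) (h : ℝ) (hh : 0 < h)
    (π : EuclideanSpace ℝ (Fin d) → ℝ) (hπ_pos : ∀ x, 0 < π x) (hπ_cont : Continuous π)
    (hπ_int : Integrable π volume) :
    SPS.UniformlyErgodic (SPS.spsKernel d R h π) (SPS.target π) ↔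
      BddAbove (Set.range fun x : EuclideanSpace ℝ (Fin d) => π x * (R ^ 2 + ‖x‖ ^ 2) ^ d) :=
  ⟨SPS.bddAbove_of_uniformlyErgodic hd hR hh hπ_cont.measurable hπ_pos,
    SPS.uniformlyErgodic_of_bddAbove hd hR hh hπ_pos hπ_cont hπ_int⟩
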